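/- Let $M,N$ be smooth manifolds (finite-dimensional, Hausdorff, second countable, without boundary) and let $\Phi\colon M\to N$ be a smooth map. Let $\mathcal U=\{U_i\}_{i\in I}$ and $\mathcal V=\{V_j\}_{j\in J}$ be good covers of $M$ and $N$ (open covers all of whose nonempty finite intersections are contractible), and let $r\colon I\to J$ satisfy $\Phi(U_i)\subseteq V_{r(i)}$ for all $i$. Let $\check C^p(\mathcal U,\mathbb Z)$ be the group of families of locally constant functions $U_{i_0}\cap\dots\cap U_{i_p}\to\mathbb Z$, antisymmetric in the indices, with the usual Čech differential $d$, and similarly for $\mathcal V$. Let $H^2(\Phi,\mathbb Z)$ be the second cohomology group of the mapping cone $\check C^{n-1}(\mathcal U,\mathbb Z)\oplus\check C^{n}(\mathcal V,\mathbb Z)$ with differential $d(\alpha,\beta)=(\Phi^*\beta-d\alpha,\,d\beta)$, where $(\Phi^*\beta)_{i_0\dots i_p}=\beta_{r(i_0)\dots r(i_p)}\circ\Phi$. A relative line bundle for $\Phi$ is a pair $(\sigma,L)$, where $L$ is a smooth Hermitian line bundle over $N$ and $\sigma$ is a smooth unitary section of $\Phi^*L$. An isomorphism $(\sigma,L)\to(\sigma',L')$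 is a smooth isometric isomorphism $L\to L'$ over $N$ that carries $\sigma$ to $\sigma'$. Let $\mathrm{Pic}(\Phi)$ be the set of isomorphism classes. 1. $(\sigma,L)\cdot(\sigma',L')=(\sigma\otimes\sigma',\,L\otimes L')$ makes $\mathrm{Pic}(\Phi)$ an abelian group. 2. The classes of those $(\sigma,L)$ for which there are a smooth unitary section $\tau$ of $L$ over $N$ and a function $k\in C^\infty(M,\mathbb R)$ with $\Phi^*\tau/\sigma=\exp(2\pi\sqrt{-1}\,k)$ form a subgroup $\mathrm{Pic}_0(\Phi)$ of $\mathrm{Pic}(\Phi)$. 3. There is a short exact sequence of abelian groups $$0\to \mathrm{Pic}_0(\Phi)\to \mathrm{Pic}(\Phi)\xrightarrow{\ \chi\ } H^2(\Phi,\mathbb Z)\to 0,$$ where the first map is the inclusion and $\chi$ is the relative Chern class: a cocycle represents $\chi(\sigma,L)$ if and only if it has the form $d(m,l)=(\Phi^*l-dm,\,dl)$ for some unitary sections $s_j$ of $L|_{V_j}$ and some smooth real functions $l_{jj'}$ on $V_j\cap V_{j'}$ and $m_i$ on $U_i$ with $s_{j'}=\exp(2\pi\sqrt{-1}\,l_{jj'})\,s_j$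 and $\Phi^*s_{r(i)}=\exp(2\pi\sqrt{-1}\,m_i)\,\sigma$. 4. Call $(\sigma_1,L_1)$ and $(\sigma_2,L_2)$ equivalent if $L_1L_2^{-1}$ has a smooth unitary section $\tau$ with $\Phi^*\tau/(\sigma_1\sigma_2^{-1})=\exp(2\pi\sqrt{-1}\,f)$ for some $f\in C^\infty(M,\mathbb R)$. Then two relative line bundles have the same image under $\chi$ if and only if they are equivalent, so $\chi$ induces a bijection from the set of equivalence classes of relative line bundles onto $H^2(\Phi,\mathbb Z)$. -/

import Mathlib

open scoped Manifold ContDiff Bundle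
open Bundle

/-! ### Čech cochains of an open cover and of a map -/

section Cech

variable {X Y ι κ : Type*}

/-- The intersection `U_{α₀} ∩ ⋯ ∩ U_{αₚ₋₁}` of the members of a cover with indices `α`. -/
def cechInter (U : ι → Set X) {p : ℕ} (α : Fin p → ι) : Set X := ⋂ k, U (α k)

theorem cechInter_comp {U : ι → Set X} {p q : ℕ} {α : Fin p → ι} (g : Fin q → Fin p) {x : X}
    (hx : x ∈ cechInter U α) : x ∈ cechInter U (α ∘ g) :=
  Set.mem_iInter.2 fun k => Set.mem_iInter.1 hx (g k)

theorem cechInter_map {U : ι → Set X} {V : κ → Set Y} {r : ι → κ} {φ : X → Y}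
    (hr : ∀ i, Set.MapsTo φ (U i) (V (r i))) {p : ℕ} {α : Fin p → ι} {x : X}
    (hx : x ∈ cechInter U α) : φ x ∈ cechInter V (r ∘ α) :=
  Set.mem_iInter.2 fun k => hr (α k) (Set.mem_iInter.1 hx k)

/-- A good cover: an open cover all of whose nonempty finite intersections are contractible. -/
structure IsGoodCover [TopologicalSpace X] (U : ι → Set X) : Prop where
  isOpen : ∀ i, IsOpen (U i)
  iUnion_eq : ⋃ i, U i = Set.univ
  contractible : ∀ (p : ℕ) (α : Fin (p + 1) → ι), (cechInter U α).Nonempty →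
    ContractibleSpace (cechInter U α)

/-- Families of arbitrary integer functions `f_α : U_{α₀⋯αₚ} → ℤ`. -/
abbrev CechFamily (U : ι → Set X) (p : ℕ) : Type _ :=
  ∀ α : Fin (p + 1) → ι, cechInter U α → ℤ

/-- The group `Čᵖ(U, ℤ)` of Čech `p`-cochains: families of locally constant functions
`f_α : U_{α₀⋯αₚ} → ℤ` that are antisymmetric in the indices. -/
def cechCochain [TopologicalSpace X] (U : ι → Set X) (p : ℕ) : AddSubgroup (CechFamily U p) where
  carrier := {f | (∀ α, IsLocallyConstant (f α)) ∧
    ∀ (e : Equiv.Perm (Fin (p + 1))) (α : Fin (p + 1) → ι) (x : cechInter U α),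
      f (α ∘ e) ⟨x, cechInter_comp e x.2⟩ = (Equiv.Perm.sign e : ℤ) * f α x}
  zero_mem' := ⟨fun _ => IsLocallyConstant.const 0, fun _ _ _ => by simp⟩
  add_mem' := fun {f g} hf hg => ⟨fun α => (hf.1 α).add (hg.1 α), fun e α x => by
    simp only [Pi.add_apply, hf.2 e α x, hg.2 e α x, mul_add]⟩
  neg_mem' := fun {f} hf => ⟨fun α => (hf.1 α).neg, fun e α x => by
    simp only [Pi.neg_apply, hf.2 e α x, mul_neg]⟩

/-- The Čech differential `(d f)_{α₀⋯αₚ₊₁} = ∑ₖ (-1)ᵏ f_{α₀⋯α̂ₖ⋯αₚ₊₁}`. -/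
def cechD (U : ι → Set X) (p : ℕ) : CechFamily U p →+ CechFamily U (p + 1) where
  toFun f α x := ∑ k : Fin (p + 2), (-1) ^ (k : ℕ) *
    f (α ∘ k.succAbove) ⟨x, cechInter_comp k.succAbove x.2⟩
  map_zero' := by ext; simp
  map_add' f g := by ext; simp [mul_add, Finset.sum_add_distrib]

/-- The pull-back `(φ^* f)_{α₀⋯αₚ} = f_{r(α₀)⋯r(αₚ)} ∘ φ` of cochains. -/
def cechPullback (U : ι → Set X) (V : κ → Set Y) (r : ι → κ) (φ : X → Y)
    (hr : ∀ i, Set.MapsTo φ (U i) (V (r i))) (p : ℕ) : CechFamily V p →+ CechFamily U p where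
  toFun f α x := f (r ∘ α) ⟨φ x, cechInter_map hr x.2⟩
  map_zero' := rfl
  map_add' _ _ := rfl

/-- The differential `d(α, β) = (φ^* β - d α, d β)` of the algebraic mapping cone of `φ^*`,
from degree `p + 1` to degree `p + 2`, where degree `n` of the cone is `Čⁿ⁻¹(U) ⊕ Čⁿ(V)`. -/
def coneD (U : ι → Set X) (V : κ → Set Y) (r : ι → κ) (φ : X → Y)
    (hr : ∀ i, Set.MapsTo φ (U i) (V (r i))) (p : ℕ) :
    CechFamily U p × CechFamily V (p + 1) →+ CechFamily U (p + 1) × CechFamily V (p + 2) :=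
  AddMonoidHom.prod
    ((cechPullback U V r φ hr (p + 1)).comp (AddMonoidHom.snd _ _) -
      (cechD U p).comp (AddMonoidHom.fst _ _))
    ((cechD V (p + 1)).comp (AddMonoidHom.snd _ _))

variable [TopologicalSpace X] [TopologicalSpace Y]

/-- The cocycles in the degree two part `Č¹(U, ℤ) ⊕ Č²(V, ℤ)` of the mapping cone. -/
def relCocycle (U : ι → Set X) (V : κ → Set Y) (r : ι → κ) (φ : X → Y)
    (hr : ∀ i, Set.MapsTo φ (U i) (V (r i))) :
    AddSubgroup (CechFamily U 1 × CechFamily V 2) :=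
  (cechCochain U 1).prod (cechCochain V 2) ⊓ (coneD U V r φ hr 1).ker

/-- The coboundaries `d(α, β)` with `(α, β) ∈ Č⁰(U, ℤ) ⊕ Č¹(V, ℤ)`. -/
def relCoboundary (U : ι → Set X) (V : κ → Set Y) (r : ι → κ) (φ : X → Y)
    (hr : ∀ i, Set.MapsTo φ (U i) (V (r i))) :
    AddSubgroup (CechFamily U 1 × CechFamily V 2) :=
  ((cechCochain U 0).prod (cechCochain V 1)).map (coneD U V r φ hr 0)

/-- The relative Čech cohomology group `H²(φ, ℤ)`: the second cohomology of the algebraic mapping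
cone of `φ^* : Č(V, ℤ) → Č(U, ℤ)`. -/
abbrev RelH2 (U : ι → Set X) (V : κ → Set Y) (r : ι → κ) (φ : X → Y)
    (hr : ∀ i, Set.MapsTo φ (U i) (V (r i))) : Type _ :=
  relCocycle U V r φ hr ⧸ (relCoboundary U V r φ hr).addSubgroupOf (relCocycle U V r φ hr)

end Cech

/-! ### Hermitian line bundles -/

noncomputable section

variable {EM HM EN HN : Type*}
  [NormedAddCommGroup EM] [NormedSpace ℝ EM] [TopologicalSpace HM]
  [NormedAddCommGroup EN] [NormedSpace ℝ EN] [TopologicalSpace HN]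

/-- A smooth Hermitian line bundle over `N`: a complex vector bundle with model fiber `ℂ`, whose
fibers are complex inner product spaces, such that the bundle and the inner product are smooth.
(Smoothness refers to the underlying real bundle; since the trivializations in the atlas are
complex linear, smoothness of the real part of the Hermitian product is that of the product, and
`realVectorBundle` is only the restriction of scalars of `vectorBundle`.) -/
structure HermitianLineBundle (J : ModelWithCorners ℝ EN HN) (N : Type*) [TopologicalSpace N]
    [ChartedSpace HN N] where
  Fiber : N → Type
  [normed : ∀ y, NormedAddCommGroup (Fiber y)]
  [innerProd : ∀ y, InnerProductSpace ℂ (Fiber y)]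
  [topTotal : TopologicalSpace (TotalSpace ℂ Fiber)]
  [fiberBundle : FiberBundle ℂ Fiber]
  [vectorBundle : VectorBundle ℂ ℂ Fiber]
  [realVectorBundle : VectorBundle ℝ ℂ Fiber]
  [smooth : ContMDiffVectorBundle ∞ ℂ Fiber J]
  [smoothMetric : letI := fun y => InnerProductSpace.complexToReal (G := Fiber y)
    IsContMDiffRiemannianBundle J ∞ ℂ Fiber]

attribute [instance] HermitianLineBundle.normed HermitianLineBundle.innerProd
  HermitianLineBundle.topTotal HermitianLineBundle.fiberBundle HermitianLineBundle.vectorBundle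
  HermitianLineBundle.realVectorBundle HermitianLineBundle.smooth

/-- The number `exp (2 π √-1 t)`. -/
def phase (t : ℝ) : ℂ := Complex.exp (2 * Real.pi * Complex.I * t)

variable {I : ModelWithCorners ℝ EM HM} {J : ModelWithCorners ℝ EN HN}
  {M N : Type*} [TopologicalSpace M] [ChartedSpace HM M] [TopologicalSpace N] [ChartedSpace HN N]

/-- `s` is a smooth unitary section of `L` over `V` (its values outside `V` are irrelevant). -/
def HermitianLineBundle.IsUnitarySectionOn (L : HermitianLineBundle J N) (s : ∀ y, L.Fiber y)
    (V : Set N) : Prop :=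
  ContMDiffOn J (J.prod 𝓘(ℝ, ℂ)) ∞ (fun y => (⟨y, s y⟩ : TotalSpace ℂ L.Fiber)) V ∧
    ∀ y ∈ V, ‖s y‖ = 1

/-- A relative line bundle for `Φ : M → N`: a Hermitian line bundle `L` over `N` together with a
smooth unitary section `σ` of the pull-back bundle `Φ^* L`, whose fiber at `x` is `L_{Φ x}`. -/
structure RelLineBundle (Φ : C^∞⟮I, M; J, N⟯) where
  L : HermitianLineBundle J N
  σ : ∀ x : M, L.Fiber (Φ x)
  smooth_σ : ContMDiff I (I.prod 𝓘(ℝ, ℂ)) ∞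
    (fun x : M => (⟨x, σ x⟩ : TotalSpace ℂ (Φ *ᵖ L.Fiber)))
  norm_σ : ∀ x, ‖σ x‖ = 1

namespace RelLineBundle

variable {Φ : C^∞⟮I, M; J, N⟯}

/-- `P` and `Q` are isomorphic: there is a smooth isometric isomorphism of the line bundles over
`N` (with smooth inverse) which carries the section of the first to that of the second. -/
def Iso (P Q : RelLineBundle Φ) : Prop :=
  ∃ φ : ∀ y, P.L.Fiber y ≃ₗᵢ[ℂ] Q.L.Fiber y,
    ContMDiff (J.prod 𝓘(ℝ, ℂ)) (J.prod 𝓘(ℝ, ℂ)) ∞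
      (fun v : TotalSpace ℂ P.L.Fiber => (⟨v.1, φ v.1 v.2⟩ : TotalSpace ℂ Q.L.Fiber)) ∧
    ContMDiff (J.prod 𝓘(ℝ, ℂ)) (J.prod 𝓘(ℝ, ℂ)) ∞
      (fun v : TotalSpace ℂ Q.L.Fiber => (⟨v.1, (φ v.1).symm v.2⟩ : TotalSpace ℂ P.L.Fiber)) ∧
    ∀ x, φ (Φ x) (P.σ x) = Q.σ x

instance setoid (Φ : C^∞⟮I, M; J, N⟯) : Setoid (RelLineBundle Φ) where
  r := Iso
  iseqv :=
    { refl := fun _ => ⟨fun _ => .refl _ _, contMDiff_id, contMDiff_id, fun _ => rfl⟩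
      symm := fun ⟨φ, h₁, h₂, h₃⟩ => ⟨fun y => (φ y).symm, h₂, h₁, fun x => by simp [← h₃ x]⟩
      trans := fun ⟨φ, h₁, h₂, h₃⟩ ⟨ψ, k₁, k₂, k₃⟩ =>
        ⟨fun y => (φ y).trans (ψ y), k₁.comp h₁, h₂.comp k₂, fun x => by simp [h₃ x, k₃ x]⟩ }

/-- `R` is a tensor product of `P` and `Q`: there is a smooth fiberwise bilinear map
`μ : P.L × Q.L → R.L` with `‖μ u v‖ = ‖u‖ ‖v‖`, that is, a smooth unitary isomorphism
`P.L ⊗ Q.L ≅ R.L`, which carries `P.σ ⊗ Q.σ` to `R.σ`. -/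
def IsTensorProduct (P Q R : RelLineBundle Φ) : Prop :=
  ∃ μ : ∀ y, P.L.Fiber y →ₗ[ℂ] Q.L.Fiber y →ₗ[ℂ] R.L.Fiber y,
    ContMDiff (J.prod 𝓘(ℝ, ℂ × ℂ)) (J.prod 𝓘(ℝ, ℂ)) ∞
      (fun v : TotalSpace (ℂ × ℂ) (P.L.Fiber ×ᵇ Q.L.Fiber) =>
        (⟨v.1, μ v.1 v.2.1 v.2.2⟩ : TotalSpace ℂ R.L.Fiber)) ∧
    (∀ y u v, ‖μ y u v‖ = ‖u‖ * ‖v‖) ∧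
    ∀ x, μ (Φ x) (P.σ x) (Q.σ x) = R.σ x

/-- The condition defining `Pic₀(Φ)`: there are a global unitary section `τ` of `L` and a function
`k ∈ C^∞(M, ℝ)` with `Φ^* τ / σ = exp (2 π √-1 k)`. -/
def IsInPicZero (P : RelLineBundle Φ) : Prop :=
  ∃ τ : ∀ y, P.L.Fiber y, P.L.IsUnitarySectionOn τ Set.univ ∧
    ∃ k : M → ℝ, ContMDiff I 𝓘(ℝ, ℝ) ∞ k ∧ ∀ x, τ (Φ x) = phase (k x) • P.σ x

/-- Equivalence of relative line bundles `(σ₁, L₁)` and `(σ₂, L₂)`: for the pair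
`K = (σ₁ σ₂⁻¹, L₁ L₂⁻¹)`, the line bundle `L₁ L₂⁻¹` has a unitary section `τ` such that
`Φ^* τ / (σ₁ σ₂⁻¹) = exp (2 π √-1 f)` for some `f ∈ C^∞(M, ℝ)`. -/
def Equivalent (P₁ P₂ : RelLineBundle Φ) : Prop :=
  ∃ K : RelLineBundle Φ, IsTensorProduct K P₂ P₁ ∧ K.IsInPicZero

/-- `(b, a)` is a Čech representative of the relative Chern class of `(σ, L)`: for some unitary
sections `s_j` of `L` over `V_j` and smooth real functions `l_{jj'}`, `m_i` with
`s_{j'} = exp (2 π √-1 l_{jj'}) s_j` on `V_{jj'}` and `Φ^* s_{r(i)} = exp (2 π √-1 m_i) σ` on `U_i`,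
one has `(b, a) = d(m, l) = (Φ^* l - d m, d l)`. -/
def IsChernCocycle (P : RelLineBundle Φ) {ι κ : Type*} (U : ι → Set M) (V : κ → Set N) (r : ι → κ)
    (hr : ∀ i, Set.MapsTo Φ (U i) (V (r i))) (c : relCocycle U V r Φ hr) : Prop :=
  ∃ (s : κ → ∀ y, P.L.Fiber y) (l : κ → κ → N → ℝ) (m : ι → M → ℝ),
    (∀ j, P.L.IsUnitarySectionOn (s j) (V j)) ∧
    (∀ j j', ContMDiffOn J 𝓘(ℝ, ℝ) ∞ (l j j') (V j ∩ V j')) ∧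
    (∀ j j', ∀ y ∈ V j ∩ V j', s j' y = phase (l j j' y) • s j y) ∧
    (∀ i, ContMDiffOn I 𝓘(ℝ, ℝ) ∞ (m i) (U i)) ∧
    (∀ i, ∀ x ∈ U i, s (r i) (Φ x) = phase (m i x) • P.σ x) ∧
    (∀ (α : Fin 2 → ι) (x : cechInter U α), (c.1.1 α x : ℝ) =
      l (r (α 0)) (r (α 1)) (Φ x) - (m (α 1) x - m (α 0) x)) ∧
    ∀ (α : Fin 3 → κ) (y : cechInter V α), (c.1.2 α y : ℝ) =
      l (α 1) (α 2) y - l (α 0) (α 2) y + l (α 0) (α 1) y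

end RelLineBundle

/-- The set `Pic(Φ)` of isomorphism classes of relative line bundles for `Φ`. -/
abbrev RelPic (Φ : C^∞⟮I, M; J, N⟯) : Type _ := Quotient (RelLineBundle.setoid Φ)

end

/-! ### Nowhere vanishing sections of the image of a family of idempotents -/

section Transport

open Filter Topology unitInterval

variable {X E : Type*} [TopologicalSpace X] [NormedAddCommGroup E] [NormedSpace ℂ E]

/-! The argument is the exponential sequence `0 → ℤ → C^∞(ℝ) → C^∞(U(1)) → 1`, carried out for the
mapping cone of `Φ^*`. In a unitary frame `s_j` over `V`, a relative line bundle becomes a pair of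
cochains: transition functions `g_{jj'}` on `N` and coordinates `w_j` of `σ` on `Φ⁻¹(V_j)`, with
`w_j = (g_{jj'} ∘ Φ) w_{j'}`. Such data determine the relative line bundle up to isomorphism
(`HasCoords.iso`), all such data occur (`IsCoords.exists_hasCoords`), and tensor products multiply
them. The group laws of `Pic(Φ)` are therefore those of pointwise multiplication, with complex
conjugation giving inverses.

Frames exist because a line bundle over a contractible open set has a unitary section
(`exists_isUnitarySectionOn`). For this the bundle is embedded in a trivial Hilbert bundle, and a
vector is transported along a contraction by successive orthogonal projections; the resulting
continuous section is then smoothed and normalized.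

On a good cover, unitary functions have smooth real logarithms, so frame data lift to real
potentials `(l, m)` whose cone differential is integral; its class is `χ`. Changing frames or
logarithms changes the cocycle by an integral coboundary (`IsPotential.mk_eq_mk`), and every
cohomologous cocycle arises in this way.

Conversely, sheaves of smooth real functions are fine. Each integral cone cocycle thus has a smooth
potential (`IsPotential.exists_of_cocycle`), whose exponentials are frame data of a relative line
bundle; this gives surjectivity. If the cocycle is zero, then `l` is a smooth coboundary `dk`, and
correcting the frame by `exp(-2π√-1 k)` produces a global `τ` together with a global logarithm of
`Φ^*τ/σ`. Hence the kernel is `Pic₀(Φ)`, which in particular is a subgroup. The last statement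
compares fibers with cosets of the kernel: `K` represents the quotient of `P₁` by `P₂` exactly when
`K ⊗ P₂ ≅ P₁`. -/

theorem ContinuousLinearMap.apply_ne_zero_of_idempotent {P Q : E →L[ℂ] E} (h : ‖P - Q‖ < 1) {v : E}
    (hv : P v = v) (hv0 : v ≠ 0) : Q v ≠ 0 := by
  intro h0
  -- If `Q v = 0`, then `v = (P - Q) v` would be strictly shorter than itself.
  have h1 : ‖(P - Q) v‖ ≤ ‖P - Q‖ * ‖v‖ := (P - Q).le_opNorm v
  rw [sub_apply, hv, h0, sub_zero] at h1
  have := norm_pos_iff.2 hv0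
  nlinarith

/-- A homotopy of maps to a metric space moves by less than `1` in small time steps, and the length
of the steps may be chosen continuously in the parameter. -/
theorem exists_continuous_step {W : Type*} [PseudoMetricSpace W] [NormalSpace X]
    [ParacompactSpace X] {Q : I × X → W}
    (hQ : Continuous Q) :
    ∃ δ : C(X, ℝ), ∀ x, 0 < δ x ∧
      ∀ s t : I, |(s : ℝ) - t| ≤ δ x → dist (Q (s, x)) (Q (t, x)) < 1 := by
  -- In the uniform metric on paths, nearby parameters have uniformly close paths, so a step length
  -- found at one point also works nearby.
  let G : C(X, C(I, W)) :=
    ContinuousMap.curry ⟨fun p : X × I => Q (p.2, p.1), by fun_prop⟩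
  have hG : ∀ x t, G x t = Q (t, x) := fun _ _ => rfl
  -- The admissible step lengths at a point form an interval, so locally constant choices can be
  -- averaged.
  refine exists_continuous_forall_mem_convex_of_local_const
    (t := fun x => {d : ℝ | 0 < d ∧ ∀ s t : I, |(s : ℝ) - t| ≤ d → dist (Q (s, x)) (Q (t, x)) < 1}) ?_ ?_
  · intro x
    refine Set.OrdConnected.convex ⟨fun a ha b hb c hc => ?_⟩
    exact ⟨ha.1.trans_le hc.1, fun s t h => hb.2 s t (h.trans hc.2)⟩
  · intro x
    have huc : UniformContinuous (G x) := CompactSpace.uniformContinuous_of_continuous (G x).continuous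
    obtain ⟨δ, hδ, h⟩ := Metric.uniformContinuous_iff.1 huc (1 / 3) (by norm_num)
    refine ⟨δ / 2, ?_⟩
    filter_upwards [(G.continuous.tendsto x).eventually (Metric.ball_mem_nhds _
      (show (0 : ℝ) < 1 / 3 by norm_num))] with y hy
    refine ⟨by positivity, fun s t hst => ?_⟩
    have h1 : dist (G x s) (G x t) < 1 / 3 := h (by
      rw [Subtype.dist_eq, Real.dist_eq]; linarith)
    have h2 : ∀ t, dist (G y t) (G x t) < 1 / 3 := fun t =>
      (ContinuousMap.dist_apply_le_dist t).trans_lt hy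
    have h3 := h2 s
    have h4 := h2 t
    rw [← hG, ← hG]
    calc dist (G y s) (G y t) ≤ dist (G y s) (G x s) + dist (G x s) (G x t) + dist (G x t) (G y t) :=
          dist_triangle4 _ _ _ _
      _ < 1 := by rw [dist_comm (G x t)]; linarith

/-- Over a contractible paracompact space the image of a continuous family of nonzero idempotents
has a continuous nowhere vanishing section. -/
theorem exists_continuous_section_range_idempotent [ContractibleSpace X] [NormalSpace X]
    [ParacompactSpace X] {P : X → E →L[ℂ] E} (hP : Continuous P)
    (hid : ∀ x z, P x (P x z) = P x z) (hne : ∀ x, P x ≠ 0) :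
    ∃ v : X → E, Continuous v ∧ ∀ x, P x (v x) = v x ∧ v x ≠ 0 := by
  obtain ⟨y, ⟨F'⟩⟩ := id_nullhomotopic X
  let F := F'.symm
  obtain ⟨δ, hδ⟩ := exists_continuous_step (Q := fun p => P (F p)) (by fun_prop)
  -- The `n`th time is `min (n * δ x) 1`; the contraction `F` runs from the constant `y` at time `0`
  -- to the identity at time `1`.
  let T : ℕ → X → I := fun n x => Set.projIcc 0 1 zero_le_one (n * δ x)
  have hT : ∀ n, Continuous (T n) := fun n => continuous_projIcc.comp (by fun_prop)
  have hstep : ∀ n x, |((T n x : I) : ℝ) - T (n + 1) x| ≤ δ x := by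
    intro n x
    have h0 := (hδ x).1
    refine (Set.abs_projIcc_sub_projIcc zero_le_one).trans ?_
    rw [abs_sub_comm]
    push_cast
    rw [show ((n : ℝ) + 1) * δ x - n * δ x = δ x by ring, abs_of_pos h0]
  obtain ⟨z, hz⟩ : ∃ z, P y z ≠ 0 := by
    by_contra! h
    exact hne y (ContinuousLinearMap.ext h)
  -- Discrete transport: one vector in the image of `P y` is projected successively to the images
  -- along the path from `y` to `x`. Each step is too short to annihilate it.
  let v : ℕ → X → E := fun n => n.rec (fun _ => P y z) fun k w x => P (F (T (k + 1) x, x)) (w x)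
  have hv : ∀ n x, v (n + 1) x = P (F (T (n + 1) x, x)) (v n x) := fun _ _ => rfl
  have hcont : ∀ n, Continuous (v n) := by
    intro n
    induction n with
    | zero => exact continuous_const
    | succ k ih =>
      have := hT (k + 1)
      exact (hP.comp (F.continuous.comp (by fun_prop))).clm_apply ih
  have hmem : ∀ n x, P (F (T n x, x)) (v n x) = v n x ∧ v n x ≠ 0 := by
    intro n x
    induction n with
    | zero =>
      have : F (T 0 x, x) = y := by
        have : T 0 x = 0 := by simp [T]
        rw [this, F.apply_zero]; rfl
      rw [this]
      exact ⟨hid y z, hz⟩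
    | succ k ih =>
      refine ⟨by rw [hv, hid], ?_⟩
      rw [hv]
      exact ContinuousLinearMap.apply_ne_zero_of_idempotent
        (dist_eq_norm (P _) (P _) ▸ (hδ x).2 _ _ (hstep k x)) ih.1 ih.2
  have hone : ∀ (n : ℕ) x, 1 ≤ (n : ℝ) * δ x → F (T n x, x) = x := by
    intro n x h
    have : T n x = 1 := Set.projIcc_of_right_le _ h
    rw [this, F.apply_one]; rfl
  -- After the path has reached `x`, further projections are all `P x` and fix the vector.
  have hstable : ∀ (n k : ℕ) x, 1 ≤ (n : ℝ) * δ x → v (n + k) x = v n x := by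
    intro n k x h
    induction k with
    | zero => rfl
    | succ k ih =>
      have h0 := (hδ x).1
      have h1 : 1 ≤ ((n + k : ℕ) : ℝ) * δ x := by push_cast; nlinarith [k.cast_nonneg (α := ℝ)]
      have h2 : 1 ≤ ((n + k + 1 : ℕ) : ℝ) * δ x := by push_cast at h1 ⊢; nlinarith
      have h3 := (hmem (n + k) x).1
      rw [hone _ _ h1] at h3
      rw [← add_assoc, hv, hone _ _ h2, h3, ih]
  let N : X → ℕ := fun x => ⌈1 / δ x⌉₊
  have hN : ∀ x (n : ℕ), 1 / δ x ≤ n → 1 ≤ n * δ x := fun x n h => by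
    rwa [div_le_iff₀ (hδ x).1] at h
  have heq : ∀ x (n : ℕ), 1 / δ x ≤ n → v (N x) x = v n x := by
    intro x n h
    obtain ⟨k, rfl⟩ := Nat.exists_eq_add_of_le (Nat.ceil_le.2 h)
    exact (hstable _ k x (hN x _ (Nat.le_ceil _))).symm
  refine ⟨fun x => v (N x) x, continuous_iff_continuousAt.2 fun x => ?_, fun x => ?_⟩
  -- The number of steps `N` is not continuous, but near `x` one fixed number `n` suffices and gives
  -- the same stabilized vector.
  · obtain ⟨n, hn⟩ := exists_nat_gt (1 / δ x)
    refine (hcont n).continuousAt.congr ?_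
    have hc : ContinuousAt (fun y => 1 / δ y) x :=
      continuousAt_const.div δ.continuous.continuousAt (hδ x).1.ne'
    filter_upwards [hc.eventually_lt_const hn] with y hy
    exact (heq y n hy.le).symm
  · have := hmem (N x) x
    rwa [hone _ _ (hN x _ (Nat.le_ceil _))] at this

end Transport

/-! ### The exponential and its smooth logarithms -/

section Phase

open Filter Topology

theorem phase_add (s t : ℝ) : phase (s + t) = phase s * phase t := by
  rw [phase, phase, phase, ← Complex.exp_add]; push_cast; ring_nf

@[simp] theorem phase_zero : phase 0 = 1 := by simp [phase]

theorem phase_ne_zero (t : ℝ) : phase t ≠ 0 := Complex.exp_ne_zero _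

theorem phase_eq_circleExp (t : ℝ) : phase t = Circle.exp (2 * Real.pi * t) := by
  rw [phase, Circle.coe_exp]; push_cast; ring_nf

@[simp] theorem norm_phase (t : ℝ) : ‖phase t‖ = 1 := by
  rw [phase_eq_circleExp]; exact Circle.norm_coe _

theorem phase_neg (t : ℝ) : phase (-t) = (phase t)⁻¹ :=
  eq_inv_of_mul_eq_one_left (by rw [← phase_add, neg_add_cancel, phase_zero])

theorem phase_sub (s t : ℝ) : phase (s - t) = phase s * (phase t)⁻¹ := by
  rw [sub_eq_add_neg, phase_add, phase_neg]

theorem phase_eq_one_iff (t : ℝ) : phase t = 1 ↔ ∃ n : ℤ, t = n := by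
  have hpi : (2 * Real.pi * Complex.I : ℂ) ≠ 0 := Complex.two_pi_I_ne_zero
  rw [phase, Complex.exp_eq_one_iff]
  refine exists_congr fun n => ?_
  rw [mul_comm, mul_left_inj' hpi]
  norm_cast

@[simp] theorem phase_intCast (n : ℤ) : phase n = 1 := (phase_eq_one_iff _).2 ⟨n, rfl⟩

theorem phase_eq_phase_iff (s t : ℝ) : phase s = phase t ↔ ∃ n : ℤ, s - t = n := by
  rw [← phase_eq_one_iff, phase_sub, mul_inv_eq_one₀ (phase_ne_zero t)]

theorem contDiff_phase : ContDiff ℝ ∞ phase := by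
  unfold phase
  exact Complex.contDiff_exp.comp (contDiff_const.mul Complex.ofRealCLM.contDiff)

theorem log_phase {t : ℝ} (h : |t| < 1 / 2) : Complex.log (phase t) = 2 * Real.pi * Complex.I * t := by
  have hpi := Real.pi_pos
  rw [abs_lt] at h
  have him : (2 * Real.pi * Complex.I * t : ℂ).im = 2 * Real.pi * t := by simp
  exact Complex.log_exp (by rw [him]; nlinarith) (by rw [him]; nlinarith)

variable {E H : Type*} [NormedAddCommGroup E] [NormedSpace ℝ E] [TopologicalSpace H]
  {I : ModelWithCorners ℝ E H} {X : Type*} [TopologicalSpace X] [ChartedSpace H X]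

/-- By continuity `k` stays within `1/2` of `k x` near `x`, so there it is recovered from `phase ∘
k` by the principal logarithm, after rotating the value at `x` to `1`. -/
theorem ContMDiffAt.of_phase {k : X → ℝ} {x : X} (hk : ContinuousAt k x)
    (h : ContMDiffAt I 𝓘(ℝ, ℂ) ∞ (fun y => phase (k y)) x) : ContMDiffAt I 𝓘(ℝ, ℝ) ∞ k x := by
  let f : ℂ → ℝ := fun z => k x + (Complex.log (phase (-k x) * z)).im / (2 * Real.pi)
  have hf : ContDiffAt ℝ ∞ f (phase (k x)) := by
    have h1 : phase (-k x) * phase (k x) ∈ Complex.slitPlane := by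
      rw [← phase_add]; simp
    have h2 : ContDiffAt ℝ ∞ (fun z => Complex.log (phase (-k x) * z)) (phase (k x)) :=
      ((Complex.contDiffAt_log h1).restrict_scalars ℝ).comp _ (contDiffAt_const.mul contDiffAt_id)
    exact contDiffAt_const.add ((Complex.imCLM.contDiff.contDiffAt.comp _ h2).div_const _)
  refine (hf.contMDiffAt.comp x h).congr_of_eventuallyEq ?_
  filter_upwards [hk.eventually (Metric.ball_mem_nhds _ (show (0 : ℝ) < 1 / 2 by norm_num))]
    with y hy
  rw [Real.dist_eq] at hy
  simp only [f, Function.comp, ← phase_add]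
  rw [neg_add_eq_sub, log_phase hy]
  have := Real.pi_pos.ne'
  simp

/-- A smooth function with values of norm one on a contractible open set has a smooth logarithm. -/
theorem exists_contMDiffOn_phase_eq [LocallyPathConnectedSpace X] {V : Set X} (hV : IsOpen V)
    (hc : V.Nonempty → ContractibleSpace V) {u : X → ℂ} (hu : ContMDiffOn I 𝓘(ℝ, ℂ) ∞ u V)
    (hn : ∀ x ∈ V, ‖u x‖ = 1) :
    ∃ k : X → ℝ, ContMDiffOn I 𝓘(ℝ, ℝ) ∞ k V ∧ ∀ x ∈ V, u x = phase (k x) := by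
  classical
  rcases V.eq_empty_or_nonempty with rfl | hne
  · exact ⟨0, by simp, by simp⟩
  have := hc hne
  have := hV.locallyPathConnectedSpace
  let f : C(V, Circle) := ⟨fun x => ⟨u x, mem_sphere_zero_iff_norm.2 (hn x x.2)⟩,
    (continuousOn_iff_continuous_domRestrict.1 hu.continuousOn).subtype_mk _⟩
  obtain ⟨a, ha⟩ := hne
  obtain ⟨e, he⟩ : ∃ e, Circle.exp e = f ⟨a, ha⟩ := ⟨_, Circle.exp_arg _⟩
  -- A contractible, locally path connected `V` admits lifts through the covering `Circle.exp`.
  obtain ⟨F, ⟨-, hF⟩, -⟩ := Circle.isCoveringMap_exp.existsUnique_continuousMap_lifts f ⟨a, ha⟩ e he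
  let k : X → ℝ := fun x => if hx : x ∈ V then F ⟨x, hx⟩ / (2 * Real.pi) else 0
  have hk : ∀ x ∈ V, u x = phase (k x) := by
    intro x hx
    have h1 : Circle.exp (F ⟨x, hx⟩) = f ⟨x, hx⟩ := congrFun hF ⟨x, hx⟩
    have h2 : 2 * Real.pi * k x = F ⟨x, hx⟩ := by
      have := Real.pi_pos.ne'
      simp only [k, hx, dite_true]
      field_simp
    rw [phase_eq_circleExp, h2, h1]
    rfl
  have hkc : ContinuousOn k V := by
    rw [continuousOn_iff_continuous_domRestrict]
    have : V.domRestrict k = fun x => F x / (2 * Real.pi) := by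
      ext x
      simp [k]
    rw [this]
    fun_prop
  refine ⟨k, fun x hx => ContMDiffAt.contMDiffWithinAt (ContMDiffAt.of_phase
    (hkc.continuousAt (hV.mem_nhds hx)) ?_), hk⟩
  exact (hu.contMDiffAt (hV.mem_nhds hx)).congr_of_eventuallyEq <|
    Filter.eventuallyEq_of_mem (hV.mem_nhds hx) fun y hy => (hk y hy).symm

end Phase

/-! ### Orthogonal projection to a line -/

section LineProj

variable {H : Type*} [NormedAddCommGroup H] [InnerProductSpace ℂ H]

/-- The orthogonal projection to the line spanned by `w`. -/
noncomputable def lineProj (w : H) : H →L[ℂ] H :=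
  ((‖w‖ : ℂ) ^ 2)⁻¹ • InnerProductSpace.rankOne ℂ w w

theorem lineProj_apply (w z : H) :
    lineProj w z = (((‖w‖ : ℂ) ^ 2)⁻¹ * inner ℂ w z) • w := by
  simp [lineProj, smul_smul]

theorem lineProj_self {w : H} (hw : w ≠ 0) : lineProj w w = w := by
  have h2 : (‖w‖ : ℂ) ≠ 0 := by simpa using hw
  rw [lineProj_apply, inner_self_eq_norm_sq_to_K]
  simp [h2]

/-- The projection depends only on the line, so it may be computed with any local frame of a line
bundle. -/
theorem lineProj_smul {c : ℂ} (hc : c ≠ 0) {w : H} (hw : w ≠ 0) :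
    lineProj (c • w) = lineProj w := by
  ext1 z
  have h1 : (‖c‖ : ℂ) ≠ 0 := by simpa using hc
  have h2 : (‖w‖ : ℂ) ≠ 0 := by simpa using hw
  rw [lineProj_apply, lineProj_apply, norm_smul, inner_smul_left, smul_smul]
  congr 1
  have h3 : (starRingEnd ℂ) c * c = (‖c‖ : ℂ) ^ 2 := Complex.conj_mul' c
  push_cast
  field_simp
  linear_combination (inner ℂ w z) * h3

theorem continuousAt_lineProj {w : H} (hw : w ≠ 0) : ContinuousAt (lineProj : H → H →L[ℂ] H) w := by
  have h2 : ((‖w‖ : ℂ) ^ 2) ≠ 0 := by simpa using hw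
  have h3 : Continuous fun w : H => InnerProductSpace.rankOne ℂ w w := by
    have h4 : Continuous (innerSL ℂ : H →L⋆[ℂ] H →L[ℂ] ℂ) := ContinuousLinearMap.continuous _
    exact (ContinuousLinearMap.smulRightL ℂ H H).continuous₂.comp (h4.prodMk continuous_id)
  have h5 : ContinuousAt (fun w : H => (‖w‖ : ℂ) ^ 2) w := by fun_prop
  exact (h5.inv₀ h2).smul h3.continuousAt

end LineProj

/-! ### Continuous sections of line bundles over contractible spaces -/

section TopologicalLineBundle

open Filter Topology

variable {X : Type*} [TopologicalSpace X] {E : X → Type*} [∀ x, AddCommGroup (E x)]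
  [∀ x, Module ℂ (E x)] [∀ x, TopologicalSpace (E x)] [TopologicalSpace (TotalSpace ℂ E)]
  [FiberBundle ℂ E] [VectorBundle ℂ ℂ E]

variable (E) in
/-- The local frame of a line bundle given by the preferred trivialization at `a`. -/
noncomputable def lineFrame (a x : X) : E x := (trivializationAt ℂ E a).symmL ℂ x 1

variable (E) in
/-- The fiber coordinate of a line bundle in the preferred trivialization at `a`. -/
noncomputable def lineCoord (a x : X) : E x →ₗ[ℂ] ℂ := (trivializationAt ℂ E a).linearMapAt ℂ x

theorem lineCoord_lineFrame {a x : X} (hx : x ∈ (trivializationAt ℂ E a).baseSet) :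
    lineCoord E a x (lineFrame E a x) = 1 :=
  (trivializationAt ℂ E a).continuousLinearMapAt_symmL hx 1

theorem lineCoord_smul_lineFrame {a x : X} (hx : x ∈ (trivializationAt ℂ E a).baseSet) (v : E x) :
    lineCoord E a x v • lineFrame E a x = v := by
  rw [lineFrame, ← map_smul, smul_eq_mul, mul_one]
  exact (trivializationAt ℂ E a).symmL_continuousLinearMapAt hx v

theorem lineFrame_ne_zero {a x : X} (hx : x ∈ (trivializationAt ℂ E a).baseSet) :
    lineFrame E a x ≠ 0 := fun h => by
  simpa [h] using lineCoord_lineFrame (E := E) hx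

theorem continuousAt_lineCoord_lineFrame {a b x : X}
    (ha : x ∈ (trivializationAt ℂ E a).baseSet) (hb : x ∈ (trivializationAt ℂ E b).baseSet) :
    ContinuousAt (fun y => lineCoord E a y (lineFrame E b y)) x := by
  have hd : ContinuousAt (fun y => ((trivializationAt ℂ E b).coordChangeL ℂ
      (trivializationAt ℂ E a) y : ℂ →L[ℂ] ℂ) 1) x :=
    ((VectorBundle.continuousOn_coordChange' (R := ℂ) (trivializationAt ℂ E b)
      (trivializationAt ℂ E a)).continuousAt ((((trivializationAt ℂ E b).open_baseSet.inter
        (trivializationAt ℂ E a).open_baseSet)).mem_nhds ⟨hb, ha⟩)).clm_apply continuousAt_const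
  refine hd.congr ?_
  filter_upwards [(trivializationAt ℂ E a).open_baseSet.mem_nhds ha,
    (trivializationAt ℂ E b).open_baseSet.mem_nhds hb] with y hya hyb
  rw [ContinuousLinearEquiv.coe_coe, Trivialization.coordChangeL_apply _ _ ⟨hyb, hya⟩, lineCoord,
    Trivialization.coe_linearMapAt_of_mem _ hya, lineFrame, Trivialization.symmL_apply _ hyb]

/-- A complex line bundle over a contractible paracompact Hausdorff space has a continuous nowhere
vanishing section. -/
theorem exists_continuous_section_of_contractible [ContractibleSpace X] [T2Space X]
    [ParacompactSpace X] :
    ∃ s : ∀ x, E x, ∀ a, ∃ c : X → ℂ, ContinuousAt c a ∧ c a ≠ 0 ∧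
      ∀ᶠ x in 𝓝 a, s x = c x • lineFrame E a x := by
  classical
  have hmem (a : X) : a ∈ (trivializationAt ℂ E a).baseSet := mem_baseSet_trivializationAt ℂ E a
  have hnhds (a : X) : ∀ᶠ x in 𝓝 a, x ∈ (trivializationAt ℂ E a).baseSet :=
    (trivializationAt ℂ E a).open_baseSet.mem_nhds (hmem a)
  obtain ⟨ρ, hρ⟩ := PartitionOfUnity.exists_isSubordinate isClosed_univ
    (fun a => (trivializationAt ℂ E a).baseSet) (fun a => (trivializationAt ℂ E a).open_baseSet)
    fun a _ => Set.mem_iUnion.2 ⟨a, hmem a⟩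
  -- the embedding of the bundle in a trivial Hilbert bundle
  let F (x : X) : E x →ₗ[ℂ] lp (fun _ : X => ℂ) 2 :=
    ∑ a ∈ ρ.finsupport x, (lp.lsingle (𝕜 := ℂ) (E := fun _ : X => ℂ) 2 a) ∘ₗ
      ((ρ a x : ℂ) • lineCoord E a x)
  have hF (A : Finset X) (x : X) (hA : ρ.finsupport x ⊆ A) (v : E x) :
      F x v = ∑ a ∈ A, lp.single 2 a ((ρ a x : ℂ) * lineCoord E a x v) := by
    rw [← Finset.sum_subset hA fun a _ ha => ?_]
    · simp only [F, LinearMap.sum_apply]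
      rfl
    · have : ρ a x = 0 := by simpa using ha
      simp [this, lp.single_zero]
  have hinj (x : X) (v : E x) (h : F x v = 0) : v = 0 := by
    obtain ⟨a, ha⟩ := ρ.exists_pos (Set.mem_univ x)
    have hxa : x ∈ (trivializationAt ℂ E a).baseSet :=
      hρ a (subset_closure (Function.mem_support.2 ha.ne'))
    have h1 : (F x v : X → ℂ) a = 0 := by rw [h]; rfl
    rw [hF _ x subset_rfl, lp.coeFn_sum, Finset.sum_apply, Finset.sum_eq_single a] at h1
    · rw [lp.single_apply_self] at h1
      have h2 : lineCoord E a x v = 0 := by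
        simpa [ha.ne'] using h1
      rw [← lineCoord_smul_lineFrame hxa v, h2, zero_smul]
    · intro b _ hb
      exact lp.single_apply_ne _ _ _ hb.symm
    · intro hn
      simp [ha.ne'] at hn
  have hcont (a : X) : ContinuousAt (fun x => F x (lineFrame E a x)) a := by
    have h1 : ContinuousAt (fun x => ∑ b ∈ ρ.fintsupport a, lp.single (E := fun _ : X => ℂ) 2 b
        ((ρ b x : ℂ) * lineCoord E b x (lineFrame E a x))) a := by
      refine tendsto_finsetSum _ fun b hb => ?_
      refine (lp.isometry_single (E := fun _ : X => ℂ) (p := 2) b).continuous.continuousAt.comp ?_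
      have hab : a ∈ (trivializationAt ℂ E b).baseSet := hρ b ((ρ.mem_fintsupport_iff a b).1 hb)
      exact (Complex.continuous_ofReal.comp (ρ b).continuous).continuousAt.mul
        (continuousAt_lineCoord_lineFrame hab (hmem a))
    refine h1.congr ?_
    filter_upwards [ρ.eventually_finsupport_subset a] with x hx
    exact (hF _ x hx _).symm
  -- Projection to the embedded fiber. The frame used varies discontinuously with `x`, but near `a`
  -- the frame at `a` gives the same projection.
  let P (x : X) := lineProj (F x (lineFrame E x x))
  have hframe {a x : X} (hx : x ∈ (trivializationAt ℂ E a).baseSet) :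
      F x (lineFrame E a x) ≠ 0 := fun h => lineFrame_ne_zero hx (hinj _ _ h)
  have hP (a x : X) (hx : x ∈ (trivializationAt ℂ E a).baseSet) :
      P x = lineProj (F x (lineFrame E a x)) := by
    rw [← lineCoord_smul_lineFrame (hmem x) (lineFrame E a x), map_smul, lineProj_smul _ (hframe (hmem x))]
    intro h
    have := lineCoord_smul_lineFrame (hmem x) (lineFrame E a x)
    rw [h, zero_smul] at this
    exact lineFrame_ne_zero hx this.symm
  obtain ⟨v, hv, hPv⟩ := exists_continuous_section_range_idempotent (P := P)
    (continuous_iff_continuousAt.2 fun a =>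
      ((continuousAt_lineProj (hframe (hmem a))).comp (f := fun x => F x (lineFrame E a x)) (hcont a)).congr
        ((hnhds a).mono fun x hx => (hP a x hx).symm))
    (fun x z => by
      simp only [P]
      rw [lineProj_apply _ z, map_smul, lineProj_self (hframe (hmem x))])
    (fun x h => hframe (hmem x) (by
      rw [← lineProj_self (hframe (hmem x))]
      exact DFunLike.congr_fun h (F x (lineFrame E x x))))
  -- Coordinate of `v x`, which lies in the embedded fiber, with respect to the embedded frame
  -- vector.
  let c (a x : X) : ℂ := ((‖F x (lineFrame E a x)‖ : ℂ) ^ 2)⁻¹ * inner ℂ (F x (lineFrame E a x)) (v x)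
  have hc (a x : X) (hx : x ∈ (trivializationAt ℂ E a).baseSet) :
      F x (c a x • lineFrame E a x) = v x := by
    rw [map_smul, ← lineProj_apply, ← hP a x hx, (hPv x).1]
  refine ⟨fun x => c x x • lineFrame E x x, fun a => ⟨c a, ?_, ?_, ?_⟩⟩
  · have h2 : ((‖F a (lineFrame E a a)‖ : ℂ) ^ 2) ≠ 0 := by simpa using hframe (hmem a)
    exact (((Complex.continuous_ofReal.continuousAt.comp (hcont a).norm).pow 2).inv₀ h2).mul
      ((hcont a).inner hv.continuousAt)
  · intro h
    have := hc a a (hmem a)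
    rw [h, zero_smul, map_zero] at this
    exact (hPv a).2 this.symm
  · filter_upwards [hnhds a] with x hx
    rw [← sub_eq_zero]
    apply hinj
    rw [map_sub, hc a x hx, hc x x (hmem x), sub_self]

end TopologicalLineBundle

/-! ### Smoothing a nowhere vanishing section -/

section SmoothLineBundle

open Filter Topology

variable {E₀ H : Type*} [NormedAddCommGroup E₀] [NormedSpace ℝ E₀] [TopologicalSpace H]
  {I : ModelWithCorners ℝ E₀ H} {X : Type*} [TopologicalSpace X] [ChartedSpace H X]
  {E : X → Type*} [∀ x, AddCommGroup (E x)]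
  [∀ x, Module ℂ (E x)] [∀ x, TopologicalSpace (E x)] [TopologicalSpace (TotalSpace ℂ E)]
  [FiberBundle ℂ E] [VectorBundle ℂ ℂ E] [VectorBundle ℝ ℂ E] [ContMDiffVectorBundle ∞ ℂ E I]

theorem contMDiffOn_smul_lineFrame (a : X) (c : ℂ) :
    ContMDiffOn I (I.prod 𝓘(ℝ, ℂ)) ∞ (fun x => (⟨x, c • lineFrame E a x⟩ : TotalSpace ℂ E))
      (trivializationAt ℂ E a).baseSet := by
  rw [Trivialization.contMDiffOn_section_baseSet_iff]
  refine (contMDiffOn_const (c := c)).congr fun x hx => ?_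
  have := congrFun ((trivializationAt ℂ E a).coe_linearMapAt_of_mem (R := ℂ) hx)
    (c • lineFrame E a x)
  rw [← this]
  change lineCoord E a x (c • lineFrame E a x) = c
  rw [map_smul, lineCoord_lineFrame hx, smul_eq_mul, mul_one]

/-- A smooth complex line bundle over a contractible manifold has a smooth nowhere vanishing
section. -/
theorem exists_contMDiff_section_of_contractible [FiniteDimensional ℝ E₀] [IsManifold I ∞ X]
    [T2Space X] [SigmaCompactSpace X] [ContractibleSpace X] :
    ∃ s : ∀ x, E x, ContMDiff I (I.prod 𝓘(ℝ, ℂ)) ∞ (fun x => (⟨x, s x⟩ : TotalSpace ℂ E)) ∧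
      ∀ x, s x ≠ 0 := by
  have := I.locallyCompactSpace
  have := ChartedSpace.locallyCompactSpace H X
  obtain ⟨s, hs⟩ := exists_continuous_section_of_contractible (E := E)
  have hs0 (a : X) : s a ≠ 0 := by
    obtain ⟨c, -, hc0, hc⟩ := hs a
    rw [hc.self_of_nhds]
    exact smul_ne_zero hc0 (lineFrame_ne_zero (mem_baseSet_trivializationAt ℂ E a))
  -- The multiples `z • s x` with `0 < z.re` form a convex set that avoids zero, so smooth local
  -- sections with values in it can be glued by a partition of unity.
  obtain ⟨σ, hσ⟩ : ∃ σ : Cₛ^∞⟮I; ℂ, E⟯, ∀ x, ∃ z : ℂ, 0 < z.re ∧ σ x = z • s x := by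
    refine exists_contMDiffSection_forall_mem_convex_of_local (n := ⊤) (F_fiber := ℂ) I E
      (fun x => {v | ∃ z : ℂ, 0 < z.re ∧ v = z • s x}) ?_ fun a => ?_
    · rintro x _ ⟨z, hz, rfl⟩ _ ⟨w, hw, rfl⟩ a b ha hb hab
      refine ⟨a * z + b * w, ?_, ?_⟩
      · rw [Complex.add_re, Complex.re_ofReal_mul, Complex.re_ofReal_mul]
        rcases ha.eq_or_lt with rfl | ha
        · have : b = 1 := by linarith
          simpa [this] using hw
        · have := mul_pos ha hz
          have := mul_nonneg hb hw.le
          linarith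
      · rw [add_smul, mul_smul, mul_smul]
        rfl
    · obtain ⟨c, hcc, hc0, hc⟩ := hs a
      -- Freezing the coordinate of `s` at its value `c a` gives a smooth local section; its ratio
      -- to `s` is `c a / c x`, which is close to `1`.
      have h1 : ∀ᶠ x in 𝓝 a, 0 < (c a / c x).re := by
        have h : ContinuousAt (fun x => (c a / c x).re) a :=
          Complex.continuous_re.continuousAt.comp (continuousAt_const.div hcc hc0)
        refine h.eventually_const_lt ?_
        simp [hc0]
      refine ⟨_, Filter.inter_mem (Filter.inter_mem (hc.and h1) (hcc.eventually_ne hc0))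
        ((trivializationAt ℂ E a).open_baseSet.mem_nhds (mem_baseSet_trivializationAt ℂ E a)),
        fun x => c a • lineFrame E a x,
        (contMDiffOn_smul_lineFrame a (c a)).mono Set.inter_subset_right, ?_⟩
      rintro x ⟨⟨⟨hx1, hx2⟩, hx3⟩, -⟩
      have hx3 : c x ≠ 0 := hx3
      refine ⟨c a / c x, hx2, ?_⟩
      change c a • lineFrame E a x = (c a / c x) • s x
      rw [hx1, smul_smul, div_mul_cancel₀ _ hx3]
  refine ⟨σ, σ.contMDiff, fun x => ?_⟩
  obtain ⟨z, hz, h⟩ := hσ x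
  rw [h]
  refine smul_ne_zero (fun h0 => ?_) (hs0 x)
  simp [h0] at hz

end SmoothLineBundle

/-! ### Sections of pull-back bundles -/

section Along

variable {E₀ H E₁ H₁ : Type*} [NormedAddCommGroup E₀] [NormedSpace ℝ E₀] [TopologicalSpace H]
  {I : ModelWithCorners ℝ E₀ H} {X : Type*} [TopologicalSpace X] [ChartedSpace H X]
  [NormedAddCommGroup E₁] [NormedSpace ℝ E₁] [TopologicalSpace H₁]
  {J : ModelWithCorners ℝ E₁ H₁} {Y : Type*} [TopologicalSpace Y] [ChartedSpace H₁ Y]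
  {F : Type*} [NormedAddCommGroup F] [NormedSpace ℝ F]
  {E : Y → Type*} [∀ x, Zero (E x)] [∀ x, TopologicalSpace (E x)] [TopologicalSpace (TotalSpace F E)]
  [FiberBundle F E]

/-- A section of the pull-back of a bundle is smooth if and only if it is smooth as a map to the
total space of the bundle. -/
theorem contMDiff_pullback_section_iff (f : C^∞⟮I, X; J, Y⟯) (s : ∀ x, E (f x)) :
    ContMDiff I (I.prod 𝓘(ℝ, F)) ∞ (fun x => (⟨x, s x⟩ : TotalSpace F (f *ᵖ E))) ↔
      ContMDiff I (J.prod 𝓘(ℝ, F)) ∞ (fun x => (⟨f x, s x⟩ : TotalSpace F E)) := by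
  refine forall_congr' fun x => ?_
  rw [contMDiffAt_totalSpace, contMDiffAt_totalSpace]
  exact and_congr_left fun _ => iff_of_true contMDiffAt_id f.contMDiff.contMDiffAt

end Along

/-! ### Hermitian line bundles: smooth inner products and unitary sections -/

namespace HermitianLineBundle

open Filter Topology

variable {EN HN E₀ H : Type*}
  [NormedAddCommGroup EN] [NormedSpace ℝ EN] [TopologicalSpace HN]
  [NormedAddCommGroup E₀] [NormedSpace ℝ E₀] [TopologicalSpace H]
  {J : ModelWithCorners ℝ EN HN} {N : Type*} [TopologicalSpace N] [ChartedSpace HN N]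
  {I : ModelWithCorners ℝ E₀ H} {X : Type*} [TopologicalSpace X] [ChartedSpace H X]
  (L : HermitianLineBundle J N)

theorem finrank_fiber (y : N) : Module.finrank ℂ (L.Fiber y) = 1 := by
  rw [((trivializationAt ℂ L.Fiber y).linearEquivAt ℂ y
    (mem_baseSet_trivializationAt ℂ L.Fiber y)).finrank_eq, Module.finrank_self]

theorem inner_smul_eq {y : N} {v : L.Fiber y} (hv : ‖v‖ = 1) (w : L.Fiber y) :
    inner ℂ v w • v = w := by
  obtain ⟨c, rfl⟩ := (finrank_eq_one_iff_of_nonzero' v (norm_ne_zero_iff.1 (by simp [hv]))).1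
    (L.finrank_fiber y) w
  rw [inner_smul_right, inner_self_eq_norm_sq_to_K, hv]
  simp

variable {L} {b : X → N} {v w : ∀ x, L.Fiber (b x)} {s : Set X} {x : X}

theorem contMDiffWithinAt_smul {c : X → ℂ} (hc : ContMDiffWithinAt I 𝓘(ℝ, ℂ) ∞ c s x)
    (hv : ContMDiffWithinAt I (J.prod 𝓘(ℝ, ℂ)) ∞ (fun x => (⟨b x, v x⟩ : TotalSpace ℂ L.Fiber)) s x) :
    ContMDiffWithinAt I (J.prod 𝓘(ℝ, ℂ)) ∞
      (fun x => (⟨b x, c x • v x⟩ : TotalSpace ℂ L.Fiber)) s x := by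
  have hv' := contMDiffWithinAt_totalSpace.1 hv
  refine contMDiffWithinAt_totalSpace.2 ⟨hv'.1, ((contDiff_mul.contMDiff.contMDiffAt.comp_contMDiffWithinAt x
    (hc.prodMk_space hv'.2)).congr_of_eventuallyEq ?_ ?_)⟩
  · filter_upwards [hv'.1.continuousWithinAt ((trivializationAt ℂ L.Fiber (b x)).open_baseSet.mem_nhds
      (mem_baseSet_trivializationAt ℂ L.Fiber (b x)))] with y hy
    exact ((trivializationAt ℂ L.Fiber (b x)).linear ℂ hy).map_smul (c y) (v y)
  · exact ((trivializationAt ℂ L.Fiber (b x)).linear ℂ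
      (mem_baseSet_trivializationAt ℂ L.Fiber (b x))).map_smul (c x) (v x)

/-- Smoothness of the metric concerns only the real part of the product; the imaginary part is the
real part after multiplying the first, conjugate-linear argument by `Complex.I`. -/
theorem contMDiffWithinAt_inner
    (hv : ContMDiffWithinAt I (J.prod 𝓘(ℝ, ℂ)) ∞ (fun x => (⟨b x, v x⟩ : TotalSpace ℂ L.Fiber)) s x)
    (hw : ContMDiffWithinAt I (J.prod 𝓘(ℝ, ℂ)) ∞ (fun x => (⟨b x, w x⟩ : TotalSpace ℂ L.Fiber)) s x) :
    ContMDiffWithinAt I 𝓘(ℝ, ℂ) ∞ (fun x => inner ℂ (v x) (w x)) s x := by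
  have key {v : ∀ x, L.Fiber (b x)}
      (hv : ContMDiffWithinAt I (J.prod 𝓘(ℝ, ℂ)) ∞
        (fun x => (⟨b x, v x⟩ : TotalSpace ℂ L.Fiber)) s x) :
      ContMDiffWithinAt I 𝓘(ℝ, ℝ) ∞ (fun x => (inner ℂ (v x) (w x)).re) s x := by
    let := fun y => InnerProductSpace.complexToReal (G := L.Fiber y)
    have := L.smoothMetric
    exact ContMDiffWithinAt.inner_bundle hv hw
  have h1 := key hv
  have h2 := key (contMDiffWithinAt_smul (c := fun _ => Complex.I) contMDiffWithinAt_const hv)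
  have h3 : ContDiff ℝ ∞ fun p : ℝ × ℝ => (p.1 : ℂ) + p.2 * Complex.I :=
    (Complex.ofRealCLM.contDiff.comp contDiff_fst).add
      ((Complex.ofRealCLM.contDiff.comp contDiff_snd).mul contDiff_const)
  refine (h3.contMDiff.contMDiffAt.comp_contMDiffWithinAt x (h1.prodMk_space h2)).congr
    (fun y _ => ?_) ?_ <;>
  · simp only [Function.comp, inner_smul_left]
    apply Complex.ext <;> simp

/-- In rank one a vector is its coordinate times a unit vector, so smoothness can be tested on the
coordinate in any local unitary section. This replaces trivializations in what follows. -/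
theorem contMDiffWithinAt_iff_inner {t : ∀ y, L.Fiber y} {V : Set N} (hV : IsOpen V)
    (ht : L.IsUnitarySectionOn t V) (hb : ContMDiffWithinAt I J ∞ b s x) (hx : b x ∈ V) :
    ContMDiffWithinAt I (J.prod 𝓘(ℝ, ℂ)) ∞ (fun x => (⟨b x, w x⟩ : TotalSpace ℂ L.Fiber)) s x ↔
      ContMDiffWithinAt I 𝓘(ℝ, ℂ) ∞ (fun x => inner ℂ (t (b x)) (w x)) s x := by
  have h1 : ContMDiffWithinAt I (J.prod 𝓘(ℝ, ℂ)) ∞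
      (fun x => (⟨b x, t (b x)⟩ : TotalSpace ℂ L.Fiber)) s x :=
    (ht.1.contMDiffAt (hV.mem_nhds hx)).comp_contMDiffWithinAt x hb
  refine ⟨contMDiffWithinAt_inner h1, fun h => (contMDiffWithinAt_smul h h1).congr_of_eventuallyEq
    ?_ ?_⟩
  · filter_upwards [hb.continuousWithinAt (hV.mem_nhds hx)] with y hy
    rw [L.inner_smul_eq (ht.2 _ hy)]
  · rw [L.inner_smul_eq (ht.2 _ hx)]

theorem IsUnitarySectionOn.mono {t : ∀ y, L.Fiber y} {V W : Set N} (ht : L.IsUnitarySectionOn t V)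
    (h : W ⊆ V) : L.IsUnitarySectionOn t W :=
  ⟨ht.1.mono h, fun y hy => ht.2 y (h hy)⟩

variable (L) in
/-- A Hermitian line bundle has a smooth unitary section over each contractible open set. -/
theorem exists_isUnitarySectionOn [FiniteDimensional ℝ EN] [IsManifold J ∞ N] [T2Space N]
    [SecondCountableTopology N] {V : Set N} (hV : IsOpen V)
    (hc : V.Nonempty → ContractibleSpace V) : ∃ t, L.IsUnitarySectionOn t V := by
  classical
  rcases V.eq_empty_or_nonempty with rfl | hne
  · exact ⟨0, by simp [IsUnitarySectionOn]⟩
  let W : TopologicalSpace.Opens N := ⟨V, hV⟩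
  have : ContractibleSpace W := hc hne
  have := J.locallyCompactSpace
  have := ChartedSpace.locallyCompactSpace HN W
  let f : C^∞⟮J, W; J, N⟯ := ⟨Subtype.val, contMDiff_subtype_val⟩
  let E (x : W) : Type := L.Fiber (f x)
  let _ : TopologicalSpace (TotalSpace ℂ E) :=
    (inferInstance : TopologicalSpace (TotalSpace ℂ (f *ᵖ L.Fiber)))
  let _ : FiberBundle ℂ E := (inferInstance : FiberBundle ℂ (f *ᵖ L.Fiber))
  have : VectorBundle ℂ ℂ E := (inferInstance : VectorBundle ℂ ℂ (f *ᵖ L.Fiber))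
  have : VectorBundle ℝ ℂ E := (inferInstance : VectorBundle ℝ ℂ (f *ᵖ L.Fiber))
  have : ContMDiffVectorBundle ∞ ℂ E J :=
    (inferInstance : ContMDiffVectorBundle ∞ ℂ (f *ᵖ L.Fiber) J)
  obtain ⟨s, hs, hs0⟩ := exists_contMDiff_section_of_contractible (I := J) (E := E)
  replace hs := (contMDiff_pullback_section_iff f s).1 hs
  let t : ∀ y, L.Fiber y := fun y => if hy : y ∈ V then s ⟨y, hy⟩ else 0
  have ht : ∀ x : W, t x = s x := fun x => dif_pos x.2
  have ht0 : ∀ y ∈ V, t y ≠ 0 := fun y hy => by rw [ht ⟨y, hy⟩]; exact hs0 _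
  have hts : ContMDiffOn J (J.prod 𝓘(ℝ, ℂ)) ∞ (fun y => (⟨y, t y⟩ : TotalSpace ℂ L.Fiber)) V := by
    intro y hy
    refine ContMDiffAt.contMDiffWithinAt ?_
    have h1 := hs ⟨y, hy⟩
    refine (contMDiffAt_subtype_iff (U := W) (x := ⟨y, hy⟩)).1 (h1.congr_of_eventuallyEq ?_)
    exact Eventually.of_forall fun x => congrArg (TotalSpace.mk (x : N)) (ht x)
  refine ⟨fun y => ((‖t y‖⁻¹ : ℝ) : ℂ) • t y, fun y hy => contMDiffWithinAt_smul ?_ (hts y hy),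
    fun y hy => ?_⟩
  · have h1 := contMDiffWithinAt_inner (hts y hy) (hts y hy)
    -- The normalizing factor is `g` of the inner product of `t` with itself, and `g` is smooth
    -- where the real part is positive.
    let g : ℂ → ℂ := fun z => ((Real.sqrt z.re)⁻¹ : ℝ)
    have hz (y : N) : inner ℂ (t y) (t y) = ((‖t y‖ ^ 2 : ℝ) : ℂ) := by
      rw [inner_self_eq_norm_sq_to_K]; simp
    have h2 : ContDiffAt ℝ ∞ g (inner ℂ (t y) (t y)) := by
      have h3 : (inner ℂ (t y) (t y)).re ≠ 0 := by
        rw [hz, Complex.ofReal_re]; exact pow_ne_zero _ (norm_ne_zero_iff.2 (ht0 y hy))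
      refine Complex.ofRealCLM.contDiff.contDiffAt.comp _ (ContDiffAt.inv
        ((Complex.reCLM.contDiff.contDiffAt).sqrt h3) ?_)
      refine (Real.sqrt_pos.2 (lt_of_le_of_ne ?_ h3.symm)).ne'
      rw [hz, Complex.ofReal_re]
      positivity
    refine (h2.contMDiffAt.comp_contMDiffWithinAt y h1).congr (fun x hx => ?_) ?_ <;>
    · simp only [Function.comp, g]
      rw [hz, Complex.ofReal_re, Real.sqrt_sq (norm_nonneg _)]
  · rw [norm_smul, Complex.norm_real, norm_inv, norm_norm,
      inv_mul_cancel₀ (norm_ne_zero_iff.2 (ht0 y hy))]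

end HermitianLineBundle

/-! ### Isomorphisms and tensor products described by frames -/

noncomputable section

variable {EM HM EN HN : Type*}
  [NormedAddCommGroup EM] [NormedSpace ℝ EM] [TopologicalSpace HM]
  [NormedAddCommGroup EN] [NormedSpace ℝ EN] [TopologicalSpace HN]
  {I : ModelWithCorners ℝ EM HM} {J : ModelWithCorners ℝ EN HN}
  {M N : Type*} [TopologicalSpace M] [ChartedSpace HM M] [TopologicalSpace N] [ChartedSpace HN N]

namespace HermitianLineBundle

variable {K L L' : HermitianLineBundle J N} {κ : Type*} {V : κ → Set N}

theorem norm_inner_eq {y : N} {v : L.Fiber y} (hv : ‖v‖ = 1) (w : L.Fiber y) :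
    ‖inner ℂ v w‖ = ‖w‖ := by
  conv_rhs => rw [← L.inner_smul_eq hv w, norm_smul, hv, mul_one]

theorem inner_mul_inner {y : N} {v : L.Fiber y} (hv : ‖v‖ = 1) (w z : L.Fiber y) :
    inner ℂ w z = inner ℂ v z * inner ℂ w v := by
  conv_lhs => rw [← L.inner_smul_eq hv z, inner_smul_right]

theorem inner_self_eq_one {y : N} {v : L.Fiber y} (hv : ‖v‖ = 1) : inner ℂ v v = (1 : ℂ) := by
  rw [inner_self_eq_norm_sq_to_K, hv]; simp

variable (L) in
/-- A unitary frame: smooth unitary sections of `L` over the members of a cover. -/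
def IsFrame (V : κ → Set N) (s : κ → ∀ y, L.Fiber y) : Prop :=
  ∀ j, L.IsUnitarySectionOn (s j) (V j)

/-- In the two frames the map leaves the coordinate unchanged, and the coordinate is smooth on the
total space. -/
theorem contMDiff_fiberMap (hV : ∀ j, IsOpen (V j)) (hc : ⋃ j, V j = Set.univ)
    {s : κ → ∀ y, L.Fiber y} {t : κ → ∀ y, L'.Fiber y} (hs : L.IsFrame V s) (ht : L'.IsFrame V t)
    {f : ∀ y, L.Fiber y → L'.Fiber y}
    (hf : ∀ j, ∀ y ∈ V j, ∀ v, f y v = inner ℂ (s j y) v • t j y) :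
    ContMDiff (J.prod 𝓘(ℝ, ℂ)) (J.prod 𝓘(ℝ, ℂ)) ∞
      (fun v : TotalSpace ℂ L.Fiber => (⟨v.1, f v.1 v.2⟩ : TotalSpace ℂ L'.Fiber)) := by
  intro v
  obtain ⟨j, hj⟩ := Set.mem_iUnion.1 (hc.superset (Set.mem_univ v.1))
  have hp := contMDiffWithinAt_proj (𝕜 := ℝ) (IB := J) (n := ∞) L.Fiber (s := Set.univ) (p := v)
  have h1 := (contMDiffWithinAt_iff_inner (I := J.prod 𝓘(ℝ, ℂ)) (b := fun v : TotalSpace ℂ L.Fiber => v.1)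
    (w := fun v => v.2) (hV j) (hs j) hp hj).1 contMDiffWithinAt_id
  rw [← contMDiffWithinAt_univ]
  refine (contMDiffWithinAt_iff_inner (hV j) (ht j) hp hj).2 (h1.congr_of_eventuallyEq ?_ ?_)
  · filter_upwards [hp.continuousWithinAt ((hV j).mem_nhds hj)] with w hw
    rw [hf j _ hw, inner_smul_right, inner_self_eq_one ((ht j).2 _ hw), mul_one]
  · rw [hf j _ hj, inner_smul_right, inner_self_eq_one ((ht j).2 _ hj), mul_one]

theorem contMDiff_prod_fst : ContMDiff (J.prod 𝓘(ℝ, ℂ × ℂ)) (J.prod 𝓘(ℝ, ℂ)) ∞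
    (fun v : TotalSpace (ℂ × ℂ) (K.Fiber ×ᵇ L.Fiber) =>
      (⟨v.1, v.2.1⟩ : TotalSpace ℂ K.Fiber)) := by
  intro v
  have h := contMDiffAt_totalSpace.1
    (contMDiffAt_id (I := J.prod 𝓘(ℝ, ℂ × ℂ)) (n := ∞) (x := v))
  exact contMDiffAt_totalSpace.2 ⟨h.1, ((contDiff_fst (𝕜 := ℝ) (E := ℂ) (F := ℂ) (n := ∞)).contMDiff.contMDiffAt.comp v h.2 :)⟩

theorem contMDiff_prod_snd : ContMDiff (J.prod 𝓘(ℝ, ℂ × ℂ)) (J.prod 𝓘(ℝ, ℂ)) ∞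
    (fun v : TotalSpace (ℂ × ℂ) (K.Fiber ×ᵇ L.Fiber) =>
      (⟨v.1, v.2.2⟩ : TotalSpace ℂ L.Fiber)) := by
  intro v
  have h := contMDiffAt_totalSpace.1
    (contMDiffAt_id (I := J.prod 𝓘(ℝ, ℂ × ℂ)) (n := ∞) (x := v))
  exact contMDiffAt_totalSpace.2 ⟨h.1, ((contDiff_snd (𝕜 := ℝ) (E := ℂ) (F := ℂ) (n := ∞)).contMDiff.contMDiffAt.comp v h.2 :)⟩

theorem contMDiffOn_prod_mk {s : ∀ y, K.Fiber y} {t : ∀ y, L.Fiber y} {W : Set N}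
    (hs : ContMDiffOn J (J.prod 𝓘(ℝ, ℂ)) ∞ (fun y => (⟨y, s y⟩ : TotalSpace ℂ K.Fiber)) W)
    (ht : ContMDiffOn J (J.prod 𝓘(ℝ, ℂ)) ∞ (fun y => (⟨y, t y⟩ : TotalSpace ℂ L.Fiber)) W) :
    ContMDiffOn J (J.prod 𝓘(ℝ, ℂ × ℂ)) ∞
      (fun y => (⟨y, (s y, t y)⟩ : TotalSpace (ℂ × ℂ) (K.Fiber ×ᵇ L.Fiber))) W := fun y hy =>
  contMDiffWithinAt_totalSpace.2 ⟨contMDiffWithinAt_id,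
    (contMDiffWithinAt_totalSpace.1 (hs y hy)).2.prodMk_space
      (contMDiffWithinAt_totalSpace.1 (ht y hy)).2⟩

theorem contMDiff_fiberMap₂ (hV : ∀ j, IsOpen (V j)) (hc : ⋃ j, V j = Set.univ)
    {s : κ → ∀ y, K.Fiber y} {t : κ → ∀ y, L.Fiber y} {u : κ → ∀ y, L'.Fiber y}
    (hs : K.IsFrame V s) (ht : L.IsFrame V t) (hu : L'.IsFrame V u)
    {f : ∀ y, K.Fiber y → L.Fiber y → L'.Fiber y}
    (hf : ∀ j, ∀ y ∈ V j, ∀ v w, f y v w = (inner ℂ (s j y) v * inner ℂ (t j y) w) • u j y) :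
    ContMDiff (J.prod 𝓘(ℝ, ℂ × ℂ)) (J.prod 𝓘(ℝ, ℂ)) ∞
      (fun v : TotalSpace (ℂ × ℂ) (K.Fiber ×ᵇ L.Fiber) =>
        (⟨v.1, f v.1 v.2.1 v.2.2⟩ : TotalSpace ℂ L'.Fiber)) := by
  intro v
  obtain ⟨j, hj⟩ := Set.mem_iUnion.1 (hc.superset (Set.mem_univ v.1))
  have hp := contMDiffWithinAt_proj (𝕜 := ℝ) (IB := J) (n := ∞) (F := ℂ × ℂ) (K.Fiber ×ᵇ L.Fiber)
    (s := Set.univ) (p := v)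
  have h1 := (contMDiffWithinAt_iff_inner (hV j) (hs j) hp hj).1
    contMDiff_prod_fst.contMDiffAt.contMDiffWithinAt
  have h2 := (contMDiffWithinAt_iff_inner (hV j) (ht j) hp hj).1
    contMDiff_prod_snd.contMDiffAt.contMDiffWithinAt
  rw [← contMDiffWithinAt_univ]
  refine (contMDiffWithinAt_iff_inner (hV j) (hu j) hp hj).2
    ((contDiff_mul.contMDiff.contMDiffAt.comp_contMDiffWithinAt v
      (h1.prodMk_space h2)).congr_of_eventuallyEq ?_ ?_)
  · filter_upwards [hp.continuousWithinAt ((hV j).mem_nhds hj)] with w hw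
    rw [hf j _ hw, inner_smul_right, inner_self_eq_one ((hu j).2 _ hw), mul_one]
    rfl
  · rw [hf j _ hj, inner_smul_right, inner_self_eq_one ((hu j).2 _ hj), mul_one]
    rfl

end HermitianLineBundle

namespace RelLineBundle

open HermitianLineBundle

variable {Φ : C^∞⟮I, M; J, N⟯} {P Q R : RelLineBundle Φ} {κ : Type*} {V : κ → Set N}

theorem contMDiff_σ (P : RelLineBundle Φ) :
    ContMDiff I (J.prod 𝓘(ℝ, ℂ)) ∞ (fun x => (⟨Φ x, P.σ x⟩ : TotalSpace ℂ P.L.Fiber)) :=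
  (contMDiff_pullback_section_iff Φ P.σ).1 P.smooth_σ

/-- Relative line bundles with frames that have the same transition functions and in which the
sections have the same coordinates are isomorphic. -/
theorem iso_of_frames (hV : ∀ j, IsOpen (V j)) (hc : ⋃ j, V j = Set.univ)
    {s : κ → ∀ y, P.L.Fiber y} {t : κ → ∀ y, Q.L.Fiber y}
    (hs : P.L.IsFrame V s) (ht : Q.L.IsFrame V t)
    (hg : ∀ j j', ∀ y ∈ V j ∩ V j', inner ℂ (s j y) (s j' y) = inner ℂ (t j y) (t j' y))
    (hw : ∀ j x, Φ x ∈ V j → inner ℂ (s j (Φ x)) (P.σ x) = inner ℂ (t j (Φ x)) (Q.σ x)) :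
    P.Iso Q := by
  choose i hi using fun y => Set.mem_iUnion.1 (hc.superset (Set.mem_univ y))
  have h1 (y) := (hs (i y)).2 y (hi y)
  have h2 (y) := (ht (i y)).2 y (hi y)
  -- The map sends `s j` to `t j` for an index chosen separately at each point; `hφ` shows, from
  -- equality of the transition functions, that every other index gives the same map.
  let φ (y : N) : P.L.Fiber y ≃ₗᵢ[ℂ] Q.L.Fiber y :=
    { toFun := fun v => inner ℂ (s (i y) y) v • t (i y) y
      invFun := fun v => inner ℂ (t (i y) y) v • s (i y) y
      map_add' := fun v w => by rw [inner_add_right, add_smul]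
      map_smul' := fun c v => by rw [inner_smul_right, mul_smul, RingHom.id_apply]
      left_inv := fun v => by
        beta_reduce
        rw [inner_smul_right, inner_self_eq_one (h2 y), mul_one, inner_smul_eq _ (h1 y)]
      right_inv := fun v => by
        beta_reduce
        rw [inner_smul_right, inner_self_eq_one (h1 y), mul_one, inner_smul_eq _ (h2 y)]
      norm_map' := fun v => by
        change ‖inner ℂ (s (i y) y) v • t (i y) y‖ = ‖v‖
        rw [norm_smul, h2, mul_one, norm_inner_eq (h1 y)] }
  have hφ (j : κ) (y : N) (hy : y ∈ V j) (v) : φ y v = inner ℂ (s j y) v • t j y := by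
    change inner ℂ (s (i y) y) v • t (i y) y = _
    rw [inner_mul_inner ((hs j).2 y hy), mul_smul, hg _ _ y ⟨hi y, hy⟩, inner_smul_eq _ (h2 y)]
  refine ⟨φ, contMDiff_fiberMap hV hc hs ht hφ, contMDiff_fiberMap hV hc ht hs (f := fun y => (φ y).symm) ?_, fun x => ?_⟩
  · intro j y hy v
    rw [LinearIsometryEquiv.symm_apply_eq, hφ j y hy, inner_smul_right,
      inner_self_eq_one ((hs j).2 y hy), mul_one, inner_smul_eq _ ((ht j).2 y hy)]
  · rw [hφ _ _ (hi (Φ x)), hw _ _ (hi _), inner_smul_eq _ (h2 _)]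

/-- The product sends `(s j, t j)` to `u j`; the multiplicativity of the transition functions makes
this independent of `j`. -/
theorem isTensorProduct_of_frames (hV : ∀ j, IsOpen (V j)) (hc : ⋃ j, V j = Set.univ)
    {s : κ → ∀ y, P.L.Fiber y} {t : κ → ∀ y, Q.L.Fiber y} {u : κ → ∀ y, R.L.Fiber y}
    (hs : P.L.IsFrame V s) (ht : Q.L.IsFrame V t) (hu : R.L.IsFrame V u)
    (hg : ∀ j j', ∀ y ∈ V j ∩ V j', inner ℂ (u j y) (u j' y) =
      inner ℂ (s j y) (s j' y) * inner ℂ (t j y) (t j' y))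
    (hw : ∀ j x, Φ x ∈ V j → inner ℂ (u j (Φ x)) (R.σ x) =
      inner ℂ (s j (Φ x)) (P.σ x) * inner ℂ (t j (Φ x)) (Q.σ x)) :
    IsTensorProduct P Q R := by
  choose i hi using fun y => Set.mem_iUnion.1 (hc.superset (Set.mem_univ y))
  let μ (y : N) : P.L.Fiber y →ₗ[ℂ] Q.L.Fiber y →ₗ[ℂ] R.L.Fiber y :=
    LinearMap.mk₂ ℂ (fun v w => (inner ℂ (s (i y) y) v * inner ℂ (t (i y) y) w) • u (i y) y)
      (fun v v' w => by rw [inner_add_right, add_mul, add_smul])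
      (fun c v w => by rw [inner_smul_right, mul_assoc, mul_smul])
      (fun v w w' => by rw [inner_add_right, mul_add, add_smul])
      (fun c v w => by rw [inner_smul_right, mul_left_comm, mul_smul])
  have hμ (j : κ) (y : N) (hy : y ∈ V j) (v w) :
      μ y v w = (inner ℂ (s j y) v * inner ℂ (t j y) w) • u j y := by
    change (inner ℂ (s (i y) y) v * inner ℂ (t (i y) y) w) • u (i y) y = _
    rw [inner_mul_inner ((hs j).2 y hy), inner_mul_inner ((ht j).2 y hy) (t (i y) y),
      mul_mul_mul_comm, ← hg _ _ y ⟨hi y, hy⟩, mul_smul, inner_smul_eq _ ((hu _).2 y (hi y))]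
  refine ⟨μ, contMDiff_fiberMap₂ hV hc hs ht hu hμ, fun y v w => ?_, fun x => ?_⟩
  · rw [hμ _ y (hi y), norm_smul, norm_mul, (hu _).2 y (hi y), norm_inner_eq ((hs _).2 y (hi y)),
      norm_inner_eq ((ht _).2 y (hi y)), mul_one]
  · rw [hμ _ _ (hi _), ← hw _ _ (hi _), inner_smul_eq _ ((hu _).2 _ (hi _))]

/-- The tensor product of two frames. -/
theorem IsTensorProduct.exists_frame (h : IsTensorProduct P Q R)
    {s : κ → ∀ y, P.L.Fiber y} {t : κ → ∀ y, Q.L.Fiber y}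
    (hs : P.L.IsFrame V s) (ht : Q.L.IsFrame V t) :
    ∃ u : κ → ∀ y, R.L.Fiber y, R.L.IsFrame V u ∧
      (∀ (c c' : ℂ) j j' y, s j' y = c • s j y → t j' y = c' • t j y →
        u j' y = (c * c') • u j y) ∧
      ∀ (c c' : ℂ) j x, P.σ x = c • s j (Φ x) → Q.σ x = c' • t j (Φ x) →
        R.σ x = (c * c') • u j (Φ x) := by
  obtain ⟨μ, hμ, hn, hσ⟩ := h
  refine ⟨fun j y => μ y (s j y) (t j y), fun j => ⟨?_, fun y hy => ?_⟩, ?_, ?_⟩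
  · exact hμ.comp_contMDiffOn (contMDiffOn_prod_mk (hs j).1 (ht j).1)
  · rw [hn, (hs j).2 y hy, (ht j).2 y hy, mul_one]
  · intro c c' j j' y h h'
    simp only [h, h', map_smul, LinearMap.smul_apply, smul_smul, mul_comm c]
  · intro c c' j x h h'
    simp only [← hσ, h, h', map_smul, LinearMap.smul_apply, smul_smul, mul_comm c]

theorem Iso.exists_frame (h : P.Iso Q) {s : κ → ∀ y, P.L.Fiber y} (hs : P.L.IsFrame V s) :
    ∃ t : κ → ∀ y, Q.L.Fiber y, Q.L.IsFrame V t ∧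
      (∀ (c : ℂ) j j' y, s j' y = c • s j y → t j' y = c • t j y) ∧
      ∀ (c : ℂ) j x, P.σ x = c • s j (Φ x) → Q.σ x = c • t j (Φ x) := by
  obtain ⟨φ, hφ, -, hσ⟩ := h
  refine ⟨fun j y => φ y (s j y), fun j => ⟨?_, fun y hy => ?_⟩, ?_, ?_⟩
  · exact hφ.comp_contMDiffOn (hs j).1
  · rw [LinearIsometryEquiv.norm_map, (hs j).2 y hy]
  · intro c j j' y h
    simp only [h, map_smul]
  · intro c j x h
    simp only [← hσ, h, map_smul]

end RelLineBundle

end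

/-! ### Hermitian line bundles glued from unitary cocycles -/

noncomputable section

variable {EN HN : Type*}
  [NormedAddCommGroup EN] [NormedSpace ℝ EN] [TopologicalSpace HN]
  {J : ModelWithCorners ℝ EN HN} {N : Type*} [TopologicalSpace N] [ChartedSpace HN N]
  {κ : Type*} {V : κ → Set N}

/-- A smooth cocycle of unitary transition functions for an open cover. -/
structure UnitaryCocycle (J : ModelWithCorners ℝ EN HN) (V : κ → Set N) where
  isOpen : ∀ j, IsOpen (V j)
  iUnion_eq : ⋃ j, V j = Set.univ
  g : κ → κ → N → ℂ
  contMDiffOn_g : ∀ j j', ContMDiffOn J 𝓘(ℝ, ℂ) ∞ (g j j') (V j ∩ V j')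
  norm_g : ∀ j j', ∀ y ∈ V j ∩ V j', ‖g j j' y‖ = 1
  g_self : ∀ j, ∀ y ∈ V j, g j j y = 1
  g_mul : ∀ i j k, ∀ y ∈ V i ∩ V j ∩ V k, g i j y * g j k y = g i k y

namespace UnitaryCocycle

variable (c : UnitaryCocycle J V)

theorem exists_mem (c : UnitaryCocycle J V) (y : N) : ∃ j, y ∈ V j :=
  Set.mem_iUnion.1 (c.iUnion_eq.superset (Set.mem_univ y))

/-- The vector bundle core with the given transition functions. -/
def core (𝕜 : Type*) [NontriviallyNormedField 𝕜] [NormedAlgebra 𝕜 ℂ] :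
    VectorBundleCore 𝕜 N ℂ κ where
  baseSet := V
  isOpen_baseSet := c.isOpen
  indexAt y := (c.exists_mem y).choose
  mem_baseSet_at y := (c.exists_mem y).choose_spec
  -- Since `s_i = g_{ji} s_j`, the coordinate in the frame `i` is multiplied by `g_{ji}` to give the
  -- coordinate in the frame `j`.
  coordChange i j y := ContinuousLinearMap.mul 𝕜 ℂ (c.g j i y)
  coordChange_self i y hy v := by simp [c.g_self i y hy]
  continuousOn_coordChange i j := (ContinuousLinearMap.mul 𝕜 ℂ).continuous.comp_continuousOn
    (Set.inter_comm (V i) (V j) ▸ (c.contMDiffOn_g j i).continuousOn)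
  coordChange_comp i j k y hy v := by
    simp [← c.g_mul k j i y ⟨⟨hy.2, hy.1.2⟩, hy.1.1⟩, mul_assoc]

/-- The fibers of the line bundle with the given transition functions. -/
def Fiber (_ : UnitaryCocycle J V) (_ : N) : Type := ℂ

instance (y : N) : NormedAddCommGroup (c.Fiber y) := inferInstanceAs (NormedAddCommGroup ℂ)

instance (y : N) : InnerProductSpace ℂ (c.Fiber y) := inferInstanceAs (InnerProductSpace ℂ ℂ)

instance : TopologicalSpace (TotalSpace ℂ c.Fiber) :=
  (c.core ℂ).toFiberBundleCore.toTopologicalSpace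

instance : FiberBundle ℂ c.Fiber := (c.core ℂ).toFiberBundleCore.fiberBundle

instance : VectorBundle ℂ ℂ c.Fiber := (c.core ℂ).vectorBundle

/-- The real and complex cores have the same underlying fiber bundle core, so the real structure
lives on the topology already defined by the complex one. -/
instance : VectorBundle ℝ ℂ c.Fiber := (c.core ℝ).vectorBundle

instance : (c.core ℝ).IsContMDiff J ∞ where
  contMDiffOn_coordChange i j := (ContinuousLinearMap.mul ℝ ℂ).contMDiff.comp_contMDiffOn
    (Set.inter_comm (V i) (V j) ▸ c.contMDiffOn_g j i)

instance : ContMDiffVectorBundle ∞ ℂ c.Fiber J :=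
  (c.core ℝ).instContMDiffVectorBundle (n := ∞) (IB := J)

/-- The local trivialization over a member of the cover. -/
def triv (j : κ) : Trivialization ℂ (π ℂ c.Fiber) := (c.core ℂ).toFiberBundleCore.localTriv j

instance (j : κ) : MemTrivializationAtlas (c.triv j) := ⟨⟨j, rfl⟩⟩

open ContinuousLinearMap in
-- Multiplication by complex numbers of norm one preserves the inner product, so the metric is
-- constant in each preferred trivialization.
theorem isContMDiffRiemannianBundle :
    let := fun y => InnerProductSpace.complexToReal (G := c.Fiber y)
    IsContMDiffRiemannianBundle J ∞ ℂ c.Fiber := by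
  intro inst
  refine ⟨fun y => innerSL ℝ, fun y => ?_, fun x v w => rfl⟩
  rw [contMDiffAt_section]
  obtain ⟨C, hC⟩ : ∃ C : ℂ →L[ℝ] ℂ →L[ℝ] ℝ, ∀ v w, C v w = inner ℝ v w :=
    ⟨innerSL ℝ, fun _ _ => rfl⟩
  refine (contMDiffAt_const (c := C)).congr_of_eventuallyEq ?_
  filter_upwards [(trivializationAt ℂ c.Fiber y).open_baseSet.mem_nhds
    (mem_baseSet_trivializationAt ℂ c.Fiber y)] with z hz
  ext v w
  have hs (v : ℂ) : (trivializationAt ℂ c.Fiber y).symm z v =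
      c.g (c.exists_mem z).choose (c.exists_mem y).choose z * v :=
    (c.core ℂ).localTriv_symm_apply (i := (c.core ℂ).indexAt y) hz v
  have hn : ‖c.g (c.exists_mem z).choose (c.exists_mem y).choose z‖ = 1 :=
    c.norm_g _ _ z ⟨(c.exists_mem z).choose_spec, hz⟩
  suffices h : inner ℝ ((trivializationAt ℂ c.Fiber y).symm z v)
      ((trivializationAt ℂ c.Fiber y).symm z w) = inner ℝ v w by
    refine Eq.trans ?_ (h.trans (hC v w).symm)
    simp [hom_trivializationAt_apply, inCoordinates, hz]
    rfl
  rw [hs, hs]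
  change inner ℝ (_ * v) (_ * w) = _
  rw [Complex.inner, Complex.inner, map_mul, mul_mul_mul_comm, Complex.mul_conj', hn]
  simp

/-- The Hermitian line bundle with the given transition functions. -/
def lineBundle : HermitianLineBundle J N where
  Fiber := c.Fiber
  smoothMetric := c.isContMDiffRiemannianBundle

/-- The unitary frame of the line bundle with the given transition functions. -/
def frame (j : κ) (y : N) : c.lineBundle.Fiber y := (c.g (c.exists_mem y).choose j y : ℂ)

theorem isFrame_frame : c.lineBundle.IsFrame V c.frame := by
  refine fun j => ⟨?_, fun y hy => c.norm_g _ j y ⟨(c.exists_mem y).choose_spec, hy⟩⟩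
  have h := (c.triv j).contMDiffOn_section_baseSet_iff (IB := J) (n := ∞) (E := c.Fiber) (s := c.frame j)
  refine h.2 ((contMDiffOn_const (c := (1 : ℂ))).congr fun y hy => ?_)
  change c.g j (c.exists_mem y).choose y * c.g (c.exists_mem y).choose j y = 1
  rw [c.g_mul _ _ _ y ⟨⟨hy, (c.exists_mem y).choose_spec⟩, hy⟩, c.g_self j y hy]

theorem frame_eq {j j' : κ} {y : N} (hy : y ∈ V j ∩ V j') :
    c.frame j' y = c.g j j' y • c.frame j y := by
  change c.g (c.exists_mem y).choose j' y = c.g j j' y * c.g (c.exists_mem y).choose j y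
  rw [mul_comm, c.g_mul _ _ _ y ⟨⟨(c.exists_mem y).choose_spec, hy.1⟩, hy.2⟩]

variable {EM HM : Type*} [NormedAddCommGroup EM] [NormedSpace ℝ EM] [TopologicalSpace HM]
  {I : ModelWithCorners ℝ EM HM} {M : Type*} [TopologicalSpace M] [ChartedSpace HM M]

/-- Local unitary functions that transform by the given transition functions are the coordinates of
the section of a relative line bundle. -/
theorem exists_relLineBundle (Φ : C^∞⟮I, M; J, N⟯) (w : κ → M → ℂ)
    (hw : ∀ j, ContMDiffOn I 𝓘(ℝ, ℂ) ∞ (w j) (Φ ⁻¹' V j))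
    (hn : ∀ j, ∀ x ∈ Φ ⁻¹' V j, ‖w j x‖ = 1)
    (hg : ∀ j j' x, Φ x ∈ V j ∩ V j' → w j x = c.g j j' (Φ x) * w j' x) :
    ∃ (P : RelLineBundle Φ) (s : κ → ∀ y, P.L.Fiber y), P.L.IsFrame V s ∧
      (∀ j j', ∀ y ∈ V j ∩ V j', s j' y = c.g j j' y • s j y) ∧
      ∀ j x, Φ x ∈ V j → P.σ x = w j x • s j (Φ x) := by
  choose i hi using fun x => c.exists_mem (Φ x)
  let σ (x : M) : c.lineBundle.Fiber (Φ x) := w (i x) x • c.frame (i x) (Φ x)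
  have hσ (j : κ) (x : M) (hx : Φ x ∈ V j) : σ x = w j x • c.frame j (Φ x) := by
    change w (i x) x • c.frame (i x) (Φ x) = _
    rw [c.frame_eq ⟨hx, hi x⟩, smul_smul, mul_comm, ← hg j (i x) x ⟨hx, hi x⟩]
  refine ⟨⟨c.lineBundle, σ, (contMDiff_pullback_section_iff Φ σ).2 fun x => ?_, fun x => ?_⟩,
    c.frame, c.isFrame_frame, fun j j' y hy => c.frame_eq hy, hσ⟩
  · have ho : Φ ⁻¹' V (i x) ∈ nhds x :=
      ((c.isOpen _).preimage Φ.contMDiff.continuous).mem_nhds (hi x)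
    rw [← contMDiffWithinAt_univ]
    refine (HermitianLineBundle.contMDiffWithinAt_iff_inner (c.isOpen (i x))
      (c.isFrame_frame (i x)) Φ.contMDiff.contMDiffAt.contMDiffWithinAt (hi x)).2 ?_
    refine (((hw (i x)).contMDiffAt ho).congr_of_eventuallyEq ?_).contMDiffWithinAt
    filter_upwards [ho] with z hz
    rw [hσ _ z hz, inner_smul_right,
      HermitianLineBundle.inner_self_eq_one ((c.isFrame_frame _).2 _ hz), mul_one]
  · rw [norm_smul, hn _ _ (hi x), (c.isFrame_frame _).2 _ (hi x), mul_one]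

end UnitaryCocycle

end

/-! ### Coordinates over a good cover and the group structure of `Pic(Φ)` -/

noncomputable section

variable {EM HM EN HN : Type*}
  [NormedAddCommGroup EM] [NormedSpace ℝ EM] [TopologicalSpace HM]
  [NormedAddCommGroup EN] [NormedSpace ℝ EN] [TopologicalSpace HN]
  {I : ModelWithCorners ℝ EM HM} {J : ModelWithCorners ℝ EN HN}
  {M N : Type*} [TopologicalSpace M] [ChartedSpace HM M] [TopologicalSpace N] [ChartedSpace HN N]

section GoodCover

variable {X ι : Type*} [TopologicalSpace X] {U : ι → Set X}

theorem IsGoodCover.contractibleSpace_inter (h : IsGoodCover U) (i j : ι) (hne : (U i ∩ U j).Nonempty) :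
    ContractibleSpace (U i ∩ U j : Set X) := by
  have he : cechInter U ![i, j] = U i ∩ U j := by
    ext x; simp [cechInter]
  rw [← he] at hne ⊢
  exact h.contractible 1 _ hne

theorem IsGoodCover.contractibleSpace (h : IsGoodCover U) (i : ι) (hne : (U i).Nonempty) :
    ContractibleSpace (U i) := by
  have := h.contractibleSpace_inter i i
  rw [Set.inter_self] at this
  exact this hne

end GoodCover

namespace RelLineBundle

open HermitianLineBundle

variable {Φ : C^∞⟮I, M; J, N⟯} {P Q R : RelLineBundle Φ} {κ : Type*} {V : κ → Set N}

/-- The transition functions and the coordinates of the section of `P` in a unitary frame over `V`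
are given by `c`. -/
def HasCoords (P : RelLineBundle Φ) (V : κ → Set N) (c : (κ → κ → N → ℂ) × (κ → M → ℂ)) : Prop :=
  ∃ s : κ → ∀ y, P.L.Fiber y, P.L.IsFrame V s ∧
    (∀ j j', ∀ y ∈ V j ∩ V j', s j' y = c.1 j j' y • s j y) ∧
    ∀ j x, Φ x ∈ V j → P.σ x = c.2 j x • s j (Φ x)

variable {c c' : (κ → κ → N → ℂ) × (κ → M → ℂ)}

theorem exists_hasCoords [FiniteDimensional ℝ EN] [IsManifold J ∞ N] [T2Space N]
    [SecondCountableTopology N] (hV : IsGoodCover V) (P : RelLineBundle Φ) :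
    ∃ c, P.HasCoords V c := by
  choose s hs using fun j => P.L.exists_isUnitarySectionOn (hV.isOpen j) (hV.contractibleSpace j)
  exact ⟨(fun j j' y => inner ℂ (s j y) (s j' y), fun j x => inner ℂ (s j (Φ x)) (P.σ x)), s, hs,
    fun j j' y hy => (inner_smul_eq _ ((hs j).2 y hy.1) _).symm,
    fun j x hx => (inner_smul_eq _ ((hs j).2 _ hx) _).symm⟩

theorem inner_smul_self {L : HermitianLineBundle J N} {y : N} {v w : L.Fiber y} {z : ℂ}
    (hv : ‖v‖ = 1) (h : w = z • v) : inner ℂ v w = z := by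
  rw [h, inner_smul_right, inner_self_eq_one hv, mul_one]

/-- The coordinate functions are total, but only their values on the overlaps and preimages of the
cover carry meaning. -/
theorem HasCoords.congr (h : P.HasCoords V c)
    (h1 : ∀ j j', ∀ y ∈ V j ∩ V j', c.1 j j' y = c'.1 j j' y)
    (h2 : ∀ j x, Φ x ∈ V j → c.2 j x = c'.2 j x) : P.HasCoords V c' := by
  obtain ⟨s, hs, hg, hw⟩ := h
  exact ⟨s, hs, fun j j' y hy => by rw [← h1 j j' y hy, hg j j' y hy],
    fun j x hx => by rw [← h2 j x hx, hw j x hx]⟩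

/-- Coordinates are a complete invariant: this is what turns identities between functions into
equalities in `Pic(Φ)`. -/
theorem HasCoords.iso (hV : IsGoodCover V) (hP : P.HasCoords V c) (hQ : Q.HasCoords V c) :
    P.Iso Q := by
  obtain ⟨s, hs, hg, hw⟩ := hP
  obtain ⟨t, ht, hg', hw'⟩ := hQ
  refine iso_of_frames hV.isOpen hV.iUnion_eq hs ht (fun j j' y hy => ?_) fun j x hx => ?_
  · rw [inner_smul_self ((hs j).2 y hy.1) (hg j j' y hy),
      inner_smul_self ((ht j).2 y hy.1) (hg' j j' y hy)]
  · rw [inner_smul_self ((hs j).2 _ hx) (hw j x hx), inner_smul_self ((ht j).2 _ hx) (hw' j x hx)]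

theorem HasCoords.isTensorProduct (hV : IsGoodCover V) (hP : P.HasCoords V c)
    (hQ : Q.HasCoords V c') (hR : R.HasCoords V (c * c')) : IsTensorProduct P Q R := by
  obtain ⟨s, hs, hg, hw⟩ := hP
  obtain ⟨t, ht, hg', hw'⟩ := hQ
  obtain ⟨u, hu, hg'', hw''⟩ := hR
  refine isTensorProduct_of_frames hV.isOpen hV.iUnion_eq hs ht hu (fun j j' y hy => ?_)
    fun j x hx => ?_
  · rw [inner_smul_self ((hs j).2 y hy.1) (hg j j' y hy),
      inner_smul_self ((ht j).2 y hy.1) (hg' j j' y hy),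
      inner_smul_self ((hu j).2 y hy.1) (hg'' j j' y hy)]
    rfl
  · rw [inner_smul_self ((hs j).2 _ hx) (hw j x hx), inner_smul_self ((ht j).2 _ hx) (hw' j x hx),
      inner_smul_self ((hu j).2 _ hx) (hw'' j x hx)]
    rfl

theorem HasCoords.of_iso (hP : P.HasCoords V c) (h : P.Iso Q) : Q.HasCoords V c := by
  obtain ⟨s, hs, hg, hw⟩ := hP
  obtain ⟨t, ht, h1, h2⟩ := h.exists_frame hs
  exact ⟨t, ht, fun j j' y hy => h1 _ _ _ _ (hg j j' y hy), fun j x hx => h2 _ _ _ (hw j x hx)⟩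

theorem HasCoords.of_isTensorProduct (hP : P.HasCoords V c) (hQ : Q.HasCoords V c')
    (h : IsTensorProduct P Q R) : R.HasCoords V (c * c') := by
  obtain ⟨s, hs, hg, hw⟩ := hP
  obtain ⟨t, ht, hg', hw'⟩ := hQ
  obtain ⟨u, hu, h1, h2⟩ := h.exists_frame hs ht
  exact ⟨u, hu, fun j j' y hy => h1 _ _ _ _ _ (hg j j' y hy) (hg' j j' y hy),
    fun j x hx => h2 _ _ _ _ (hw j x hx) (hw' j x hx)⟩

/-- The conditions on transition functions and coordinates of a section. -/
structure IsCoords (J : ModelWithCorners ℝ EN HN) (I : ModelWithCorners ℝ EM HM) (Φ : M → N)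
    (V : κ → Set N) (c : (κ → κ → N → ℂ) × (κ → M → ℂ)) : Prop where
  contMDiffOn_fst : ∀ j j', ContMDiffOn J 𝓘(ℝ, ℂ) ∞ (c.1 j j') (V j ∩ V j')
  norm_fst : ∀ j j', ∀ y ∈ V j ∩ V j', ‖c.1 j j' y‖ = 1
  fst_self : ∀ j, ∀ y ∈ V j, c.1 j j y = 1
  fst_mul : ∀ i j k, ∀ y ∈ V i ∩ V j ∩ V k, c.1 i j y * c.1 j k y = c.1 i k y
  contMDiffOn_snd : ∀ j, ContMDiffOn I 𝓘(ℝ, ℂ) ∞ (c.2 j) (Φ ⁻¹' V j)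
  norm_snd : ∀ j, ∀ x ∈ Φ ⁻¹' V j, ‖c.2 j x‖ = 1
  snd_eq : ∀ j j' x, Φ x ∈ V j ∩ V j' → c.2 j x = c.1 j j' (Φ x) * c.2 j' x

theorem HasCoords.isCoords (hV : IsGoodCover V) (hP : P.HasCoords V c) : IsCoords J I Φ V c := by
  obtain ⟨s, hs, hg, hw⟩ := hP
  have hg' (j j' y) (hy : y ∈ V j ∩ V j') : c.1 j j' y = inner ℂ (s j y) (s j' y) :=
    (inner_smul_self ((hs j).2 y hy.1) (hg j j' y hy)).symm
  have hw' (j x) (hx : Φ x ∈ V j) : c.2 j x = inner ℂ (s j (Φ x)) (P.σ x) :=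
    (inner_smul_self ((hs j).2 _ hx) (hw j x hx)).symm
  refine ⟨fun j j' => ContMDiffOn.congr (fun y hy => contMDiffWithinAt_inner
      (((hs j).1.mono Set.inter_subset_left) y hy) (((hs j').1.mono Set.inter_subset_right) y hy))
      (hg' j j'), fun j j' y hy => ?_, fun j y hy => ?_, fun i j k y hy => ?_,
    fun j => ContMDiffOn.congr (fun x hx => contMDiffWithinAt_inner (b := Φ) ?_ ?_) (hw' j),
    fun j x hx => ?_, fun j j' x hx => ?_⟩
  · rw [hg' j j' y hy, norm_inner_eq ((hs j).2 y hy.1), (hs j').2 y hy.2]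
  · rw [hg' j j y ⟨hy, hy⟩, inner_self_eq_one ((hs j).2 y hy)]
  · rw [hg' i j y hy.1, hg' j k y ⟨hy.1.2, hy.2⟩, hg' i k y ⟨hy.1.1, hy.2⟩,
      inner_mul_inner ((hs j).2 y hy.1.2) (s i y) (s k y), mul_comm]
  · exact ((hs j).1.contMDiffAt ((hV.isOpen j).mem_nhds hx)).comp_contMDiffWithinAt x
      Φ.contMDiff.contMDiffAt.contMDiffWithinAt
  · exact P.contMDiff_σ.contMDiffAt.contMDiffWithinAt
  · rw [hw' j x hx, norm_inner_eq ((hs j).2 _ hx), P.norm_σ]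
  · rw [hw' j x hx.1, hw' j' x hx.2, hg' j j' _ hx, inner_mul_inner ((hs j').2 _ hx.2), mul_comm]

theorem IsCoords.exists_hasCoords (hV : IsGoodCover V) (hc : IsCoords J I Φ V c) :
    ∃ P : RelLineBundle Φ, P.HasCoords V c := by
  let Z : UnitaryCocycle J V :=
    ⟨hV.isOpen, hV.iUnion_eq, c.1, hc.contMDiffOn_fst, hc.norm_fst, hc.fst_self, hc.fst_mul⟩
  obtain ⟨P, s, h⟩ := Z.exists_relLineBundle Φ c.2 hc.contMDiffOn_snd hc.norm_snd hc.snd_eq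
  exact ⟨P, s, h⟩

theorem IsCoords.one : IsCoords J I Φ V 1 where
  contMDiffOn_fst _ _ := contMDiffOn_const
  norm_fst _ _ _ _ := norm_one
  fst_self _ _ _ := rfl
  fst_mul _ _ _ _ _ := mul_one _
  contMDiffOn_snd _ := contMDiffOn_const
  norm_snd _ _ _ := norm_one
  snd_eq _ _ _ _ := (mul_one _).symm

theorem IsCoords.mul (hc : IsCoords J I Φ V c) (hc' : IsCoords J I Φ V c') :
    IsCoords J I Φ V (c * c') where
  contMDiffOn_fst j j' := contDiff_mul.contMDiff.comp_contMDiffOn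
    ((hc.contMDiffOn_fst j j').prodMk_space (hc'.contMDiffOn_fst j j'))
  norm_fst j j' y hy := by
    change ‖c.1 j j' y * c'.1 j j' y‖ = 1
    rw [norm_mul, hc.norm_fst j j' y hy, hc'.norm_fst j j' y hy, mul_one]
  fst_self j y hy := by
    change c.1 j j y * c'.1 j j y = 1
    rw [hc.fst_self j y hy, hc'.fst_self j y hy, mul_one]
  fst_mul i j k y hy := by
    change (c.1 i j y * c'.1 i j y) * (c.1 j k y * c'.1 j k y) = c.1 i k y * c'.1 i k y
    rw [mul_mul_mul_comm, hc.fst_mul i j k y hy, hc'.fst_mul i j k y hy]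
  contMDiffOn_snd j := contDiff_mul.contMDiff.comp_contMDiffOn
    ((hc.contMDiffOn_snd j).prodMk_space (hc'.contMDiffOn_snd j))
  norm_snd j x hx := by
    change ‖c.2 j x * c'.2 j x‖ = 1
    rw [norm_mul, hc.norm_snd j x hx, hc'.norm_snd j x hx, mul_one]
  snd_eq j j' x hx := by
    change c.2 j x * c'.2 j x = (c.1 j j' (Φ x) * c'.1 j j' (Φ x)) * (c.2 j' x * c'.2 j' x)
    rw [mul_mul_mul_comm, ← hc.snd_eq j j' x hx, ← hc'.snd_eq j j' x hx]

/-- These are the data of the dual: conjugation inverts numbers of norm one, and it is smooth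
because it is real linear. -/
theorem IsCoords.star (hc : IsCoords J I Φ V c) : IsCoords J I Φ V (star c) where
  contMDiffOn_fst j j' := Complex.conjCLE.contDiff.contMDiff.comp_contMDiffOn
    (hc.contMDiffOn_fst j j')
  norm_fst j j' y hy := (norm_star _).trans (hc.norm_fst j j' y hy)
  fst_self j y hy := by
    change Star.star (c.1 j j y) = 1
    rw [hc.fst_self j y hy, star_one]
  fst_mul i j k y hy := by
    change Star.star (c.1 i j y) * Star.star (c.1 j k y) = Star.star (c.1 i k y)
    rw [← star_mul', hc.fst_mul i j k y hy]
  contMDiffOn_snd j := Complex.conjCLE.contDiff.contMDiff.comp_contMDiffOn (hc.contMDiffOn_snd j)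
  norm_snd j x hx := (norm_star _).trans (hc.norm_snd j x hx)
  snd_eq j j' x hx := by
    change Star.star (c.2 j x) = Star.star (c.1 j j' (Φ x)) * Star.star (c.2 j' x)
    rw [← star_mul', ← hc.snd_eq j j' x hx]

/-- The tensor product makes the set of isomorphism classes of relative line bundles an abelian
group. -/
theorem exists_commGroup_relPic [FiniteDimensional ℝ EN] [IsManifold J ∞ N] [T2Space N]
    [SecondCountableTopology N] (hV : IsGoodCover V) (Φ : C^∞⟮I, M; J, N⟯) :
    ∃ _ : CommGroup (RelPic Φ), ∀ P Q R : RelLineBundle Φ,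
      (⟦P⟧ * ⟦Q⟧ : RelPic Φ) = ⟦R⟧ ↔ IsTensorProduct P Q R := by
  have ex (P : RelLineBundle Φ) := exists_hasCoords hV P
  have ht (P Q : RelLineBundle Φ) : ∃ R, IsTensorProduct P Q R := by
    obtain ⟨c, hc⟩ := ex P
    obtain ⟨c', hc'⟩ := ex Q
    obtain ⟨R, hR⟩ := ((hc.isCoords hV).mul (hc'.isCoords hV)).exists_hasCoords hV
    exact ⟨R, hc.isTensorProduct hV hc' hR⟩
  choose T hT using ht
  have hcT {P Q : RelLineBundle Φ} {c c'} (hP : P.HasCoords V c) (hQ : Q.HasCoords V c') :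
      (T P Q).HasCoords V (c * c') := hP.of_isTensorProduct hQ (hT P Q)
  have hi (P : RelLineBundle Φ) : ∃ R : RelLineBundle Φ, ∃ c, P.HasCoords V c ∧
      R.HasCoords V (star c) := by
    obtain ⟨c, hc⟩ := ex P
    obtain ⟨R, hR⟩ := (hc.isCoords hV).star.exists_hasCoords hV
    exact ⟨R, c, hc, hR⟩
  choose S hS using hi
  have hstar {P : RelLineBundle Φ} {c} (hP : P.HasCoords V c) :
      (T (S P) P).HasCoords V 1 := by
    obtain ⟨c', h1, h2⟩ := hS P
    -- The product with the conjugate is `1` only where the norm is one, hence the passage through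
    -- `HasCoords.congr`.
    refine (hcT h2 h1).congr (fun j j' y hy => ?_) fun j x hx => ?_
    · change Star.star (c'.1 j j' y) * c'.1 j j' y = 1
      rw [Complex.star_def, Complex.conj_mul', (h1.isCoords hV).norm_fst j j' y hy]
      simp
    · change Star.star (c'.2 j x) * c'.2 j x = 1
      rw [Complex.star_def, Complex.conj_mul', (h1.isCoords hV).norm_snd j x hx]
      simp
  obtain ⟨O, hO⟩ := (IsCoords.one (J := J) (I := I) (Φ := Φ) (V := V)).exists_hasCoords hV
  -- Isomorphic bundles share coordinates, so both products have the same coordinates `c * c'`.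
  let m : RelPic Φ → RelPic Φ → RelPic Φ := Quotient.map₂ T fun P P' hP Q Q' hQ => by
    obtain ⟨c, hc⟩ := ex P
    obtain ⟨c', hc'⟩ := ex Q
    exact (hcT hc hc').iso hV (hcT (hc.of_iso hP) (hc'.of_iso hQ))
  let inv : RelPic Φ → RelPic Φ := fun a => ⟦S a.out⟧
  have massoc (a b d : RelPic Φ) : m (m a b) d = m a (m b d) := by
    induction a, b using Quotient.inductionOn₂ with | _ P Q
    induction d using Quotient.inductionOn with | _ R
    obtain ⟨c₁, h₁⟩ := ex P
    obtain ⟨c₂, h₂⟩ := ex Q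
    obtain ⟨c₃, h₃⟩ := ex R
    exact Quotient.sound ((hcT (hcT h₁ h₂) h₃).iso hV (mul_assoc c₁ c₂ c₃ ▸ hcT h₁ (hcT h₂ h₃)))
  have mcomm (a b : RelPic Φ) : m a b = m b a := by
    induction a, b using Quotient.inductionOn₂ with | _ P Q
    obtain ⟨c₁, h₁⟩ := ex P
    obtain ⟨c₂, h₂⟩ := ex Q
    exact Quotient.sound ((hcT h₁ h₂).iso hV (mul_comm c₂ c₁ ▸ hcT h₂ h₁))
  have mone (a : RelPic Φ) : m ⟦O⟧ a = a := by
    induction a using Quotient.inductionOn with | _ P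
    obtain ⟨c₁, h₁⟩ := ex P
    exact Quotient.sound ((hcT hO h₁).iso hV ((one_mul c₁).symm ▸ h₁))
  have minv (a : RelPic Φ) : m (inv a) a = ⟦O⟧ := by
    conv_lhs => rw [← Quotient.out_eq a]
    obtain ⟨c₁, h₁⟩ := ex (Quotient.out a)
    have h : m ⟦S (Quotient.out a)⟧ ⟦Quotient.out a⟧ = ⟦O⟧ :=
      Quotient.sound ((hstar h₁).iso hV hO)
    simpa only [inv, Quotient.out_eq] using h
  let G : CommGroup (RelPic Φ) :=
    { mul := m, one := ⟦O⟧, inv := inv, mul_assoc := massoc, one_mul := mone,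
      mul_one := fun a => (mcomm a _).trans (mone a), inv_mul_cancel := minv, mul_comm := mcomm }
  refine ⟨G, fun P Q R => ⟨fun h => ?_, fun h => ?_⟩⟩
  · obtain ⟨c, hc⟩ := ex P
    obtain ⟨c', hc'⟩ := ex Q
    have h' : (T P Q).Iso R := Quotient.exact (s := setoid Φ) h
    exact hc.isTensorProduct hV hc' ((hcT hc hc').of_iso h')
  · obtain ⟨c, hc⟩ := ex P
    obtain ⟨c', hc'⟩ := ex Q
    exact Quotient.sound ((hcT hc hc').iso hV (hc.of_isTensorProduct hc' h))

end RelLineBundle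

end

/-! ### Čech cochains and averaging by partitions of unity -/

section CechHelpers

variable {X Y ι κ : Type*} {U : ι → Set X} {p : ℕ}

open Classical in
/-- A family of functions on the intersections, extended by zero. -/
noncomputable def CechFamily.extend (f : CechFamily U p) (α : Fin (p + 1) → ι) (x : X) : ℤ :=
  if h : x ∈ cechInter U α then f α ⟨x, h⟩ else 0

namespace CechFamily

theorem extend_eq (f : CechFamily U p) {α : Fin (p + 1) → ι} {x : X} (h : x ∈ cechInter U α) :
    f.extend α x = f α ⟨x, h⟩ := dif_pos h

theorem extend_coe (f : CechFamily U p) {α : Fin (p + 1) → ι} (x : cechInter U α) :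
    f.extend α x = f α x := dif_pos x.2

theorem extend_of_notMem (f : CechFamily U p) {α : Fin (p + 1) → ι} {x : X}
    (h : x ∉ cechInter U α) : f.extend α x = 0 := dif_neg h

end CechFamily

open CechFamily

theorem mem_cechInter_one {i : ι} {x : X} : x ∈ cechInter U ![i] ↔ x ∈ U i := by
  simp [cechInter]

theorem mem_cechInter_two {α : Fin 2 → ι} {x : X} :
    x ∈ cechInter U α ↔ x ∈ U (α 0) ∧ x ∈ U (α 1) := by
  simp [cechInter, Fin.forall_fin_two]

theorem mem_cechInter_three {α : Fin 3 → ι} {x : X} :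
    x ∈ cechInter U α ↔ x ∈ U (α 0) ∧ x ∈ U (α 1) ∧ x ∈ U (α 2) := by
  simp [cechInter, Fin.forall_fin_succ]

theorem cechD_apply (f : CechFamily U p) (α : Fin (p + 2) → ι) (x : cechInter U α) :
    cechD U p f α x = ∑ k : Fin (p + 2), (-1) ^ (k : ℕ) * f.extend (α ∘ k.succAbove) x := by
  change ∑ k : Fin (p + 2), (-1) ^ (k : ℕ) *
    f (α ∘ k.succAbove) ⟨x, cechInter_comp k.succAbove x.2⟩ = _
  exact Finset.sum_congr rfl fun k _ => by rw [extend_eq f (cechInter_comp k.succAbove x.2)]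

theorem cechD_zero_apply (f : CechFamily U 0) (α : Fin 2 → ι) (x : cechInter U α) :
    cechD U 0 f α x = f.extend ![α 1] x - f.extend ![α 0] x := by
  have h0 : α ∘ Fin.succAbove 0 = ![α 1] := by ext k; fin_cases k; rfl
  have h1 : α ∘ Fin.succAbove 1 = ![α 0] := by ext k; fin_cases k; rfl
  rw [cechD_apply, Fin.sum_univ_two, h0, h1]
  simp [sub_eq_add_neg]

theorem cechD_one_apply (f : CechFamily U 1) (α : Fin 3 → ι) (x : cechInter U α) :
    cechD U 1 f α x =
      f.extend ![α 1, α 2] x - f.extend ![α 0, α 2] x + f.extend ![α 0, α 1] x := by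
  have h0 : α ∘ Fin.succAbove 0 = ![α 1, α 2] := by ext k; fin_cases k <;> rfl
  have h1 : α ∘ Fin.succAbove 1 = ![α 0, α 2] := by ext k; fin_cases k <;> rfl
  have h2 : α ∘ Fin.succAbove 2 = ![α 0, α 1] := by ext k; fin_cases k <;> rfl
  rw [cechD_apply, Fin.sum_univ_three, h0, h1, h2]
  simp [sub_eq_add_neg]

theorem cechD_two_apply (f : CechFamily U 2) (α : Fin 4 → ι) (x : cechInter U α) :
    cechD U 2 f α x = f.extend ![α 1, α 2, α 3] x - f.extend ![α 0, α 2, α 3] x +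
      f.extend ![α 0, α 1, α 3] x - f.extend ![α 0, α 1, α 2] x := by
  have h0 : α ∘ Fin.succAbove 0 = ![α 1, α 2, α 3] := by ext k; fin_cases k <;> rfl
  have h1 : α ∘ Fin.succAbove 1 = ![α 0, α 2, α 3] := by ext k; fin_cases k <;> rfl
  have h2 : α ∘ Fin.succAbove 2 = ![α 0, α 1, α 3] := by ext k; fin_cases k <;> rfl
  have h3 : α ∘ Fin.succAbove 3 = ![α 0, α 1, α 2] := by ext k; fin_cases k <;> rfl
  rw [cechD_apply, Fin.sum_univ_four, h0, h1, h2, h3]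
  simp [sub_eq_add_neg, pow_succ]

theorem cechPullback_apply {V : κ → Set Y} {r : ι → κ} {φ : X → Y}
    (hr : ∀ i, Set.MapsTo φ (U i) (V (r i))) (f : CechFamily V p) (α : Fin (p + 1) → ι)
    (x : cechInter U α) : cechPullback U V r φ hr p f α x = f.extend (r ∘ α) (φ x) :=
  (extend_eq f (cechInter_map hr x.2)).symm

variable [TopologicalSpace X]

/-- Adjacent transpositions generate the symmetric group and the sign is multiplicative. -/
theorem mem_cechCochain_of_swap {f : CechFamily U p} (hf : ∀ α, IsLocallyConstant (f α))
    (hs : ∀ (k : Fin p) (α : Fin (p + 1) → ι), ∀ x ∈ cechInter U α,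
      f.extend (α ∘ Equiv.swap k.castSucc k.succ) x = -f.extend α x) :
    f ∈ cechCochain U p := by
  have key (e : Equiv.Perm (Fin (p + 1))) : ∀ (α : Fin (p + 1) → ι), ∀ x ∈ cechInter U α,
      f.extend (α ∘ e) x = (Equiv.Perm.sign e : ℤ) * f.extend α x := by
    have he : e ∈ Submonoid.closure
        (Set.range fun i : Fin p => Equiv.swap i.castSucc i.succ) := by
      rw [Equiv.Perm.mclosure_swap_castSucc_succ]; trivial
    induction he using Submonoid.closure_induction with
    | mem e he =>
      obtain ⟨k, rfl⟩ := he
      intro α x hx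
      rw [hs k α x hx, Equiv.Perm.sign_swap k.castSucc_lt_succ.ne]
      simp
    | one => intro α x _; simp
    | mul e e' _ _ h h' =>
      intro α x hx
      rw [Equiv.Perm.coe_mul, ← Function.comp_assoc, h' _ _ (cechInter_comp e hx), h α x hx,
        Equiv.Perm.sign_mul]
      push_cast
      ring
  refine ⟨hf, fun e α x => ?_⟩
  rw [← extend_eq f (cechInter_comp e x.2), ← extend_coe f, key e α x x.2]

/-- The integers are a closed discrete subset of `ℝ`, so a continuous real function with integer
values is a locally constant integer function. -/
theorem exists_mem_cechCochain (F : (Fin (p + 1) → ι) → X → ℝ)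
    (hF : ∀ α, ContinuousOn (F α) (cechInter U α))
    (hn : ∀ α, ∀ x ∈ cechInter U α, ∃ n : ℤ, F α x = n)
    (hs : ∀ (k : Fin p) (α : Fin (p + 1) → ι), ∀ x ∈ cechInter U α,
      F (α ∘ Equiv.swap k.castSucc k.succ) x = -F α x) :
    ∃ f ∈ cechCochain U p, ∀ α, ∀ x ∈ cechInter U α, (CechFamily.extend f α x : ℝ) = F α x := by
  choose! n hn using hn
  let f : CechFamily U p := fun α x => n α x
  have hf (α) (x) (hx : x ∈ cechInter U α) : (f.extend α x : ℝ) = F α x := by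
    rw [extend_eq f hx, hn α x hx]
  refine ⟨f, mem_cechCochain_of_swap (fun α => ?_) fun k α x hx => ?_, hf⟩
  · rw [IsLocallyConstant.iff_continuous, Int.isClosedEmbedding_coe_real.continuous_iff]
    refine (continuousOn_iff_continuous_domRestrict.1 (hF α)).congr fun x => ?_
    exact hn α x x.2
  · have := hs k α x hx
    rw [← hf α x hx, ← hf _ x (cechInter_comp _ hx)] at this
    exact_mod_cast this

variable {f : CechFamily U p}

theorem extend_swap_three_left {f : CechFamily U 2} (hf : f ∈ cechCochain U 2) {i j k : ι} {x : X}
    (hi : x ∈ U i) (hj : x ∈ U j) (hk : x ∈ U k) :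
    f.extend ![j, i, k] x = -f.extend ![i, j, k] x := by
  have hx : x ∈ cechInter U ![i, j, k] := mem_cechInter_three.2 ⟨hi, hj, hk⟩
  have := hf.2 (Equiv.swap 0 1) ![i, j, k] ⟨x, hx⟩
  rw [← extend_eq f (cechInter_comp _ hx), ← extend_eq f hx, Equiv.Perm.sign_swap (by decide)] at this
  have h : ![i, j, k] ∘ Equiv.swap (0 : Fin 3) 1 = ![j, i, k] := by ext k; fin_cases k <;> rfl
  rw [h] at this
  simpa using this

theorem extend_swap_three_right {f : CechFamily U 2} (hf : f ∈ cechCochain U 2) {i j k : ι} {x : X}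
    (hi : x ∈ U i) (hj : x ∈ U j) (hk : x ∈ U k) :
    f.extend ![i, k, j] x = -f.extend ![i, j, k] x := by
  have hx : x ∈ cechInter U ![i, j, k] := mem_cechInter_three.2 ⟨hi, hj, hk⟩
  have := hf.2 (Equiv.swap 1 2) ![i, j, k] ⟨x, hx⟩
  rw [← extend_eq f (cechInter_comp _ hx), ← extend_eq f hx, Equiv.Perm.sign_swap (by decide)] at this
  have h : ![i, j, k] ∘ Equiv.swap (1 : Fin 3) 2 = ![i, k, j] := by ext k; fin_cases k <;> rfl
  rw [h] at this
  simpa using this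

variable {E H : Type*} [NormedAddCommGroup E] [NormedSpace ℝ E] [TopologicalSpace H]
  {I : ModelWithCorners ℝ E H} [ChartedSpace H X]

theorem contMDiffOn_extend (hU : ∀ i, IsOpen (U i)) (hf : f ∈ cechCochain U p)
    (α : Fin (p + 1) → ι) :
    ContMDiffOn I 𝓘(ℝ, ℝ) ∞ (fun x => (f.extend α x : ℝ)) (cechInter U α) := by
  intro x hx
  have ho : IsOpen (cechInter U α) := isOpen_iInter_of_finite fun k => hU _
  obtain ⟨W, hW, hxW, hc⟩ := (IsLocallyConstant.iff_exists_open _).1 (hf.1 α) ⟨x, hx⟩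
  obtain ⟨W', hW', rfl⟩ := isOpen_induced_iff.1 hW
  refine (contMDiffAt_const (c := (f α ⟨x, hx⟩ : ℝ))).congr_of_eventuallyEq ?_ |>.contMDiffWithinAt
  filter_upwards [hW'.mem_nhds hxW, ho.mem_nhds hx] with y hy hy'
  rw [extend_eq f hy', hc ⟨y, hy'⟩ hy]

/-- Averaging over the members of an open cover with a smooth partition of unity. -/
theorem exists_averaging [FiniteDimensional ℝ E] [IsManifold I ∞ X] [T2Space X]
    [SecondCountableTopology X] (hU : ∀ i, IsOpen (U i)) (hc : ⋃ i, U i = Set.univ) :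
    ∃ A : X → (ι → ℝ) →ₗ[ℝ] ℝ,
      (∀ x g c, (∀ i, x ∈ U i → g i = c) → A x g = c) ∧
      ∀ (g : ι → X → ℝ) (W : Set X), IsOpen W →
        (∀ i, ContMDiffOn I 𝓘(ℝ, ℝ) ∞ (g i) (U i ∩ W)) →
        ContMDiffOn I 𝓘(ℝ, ℝ) ∞ (fun x => A x fun i => g i x) W := by
  have := I.locallyCompactSpace
  have := ChartedSpace.locallyCompactSpace H X
  obtain ⟨ρ, hρ⟩ := SmoothPartitionOfUnity.exists_isSubordinate I isClosed_univ U hU hc.ge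
  have hfin (x) (g : ι → ℝ) : (Function.support fun i => ρ i x * g i).Finite :=
    (ρ.locallyFinite.point_finite x).subset fun i hi => left_ne_zero_of_mul hi
  refine ⟨fun x =>
    { toFun g := ∑ᶠ i, ρ i x * g i
      map_add' g g' := ?_
      map_smul' a g := ?_ }, fun x g c h => ?_, fun g W hW hg => ?_⟩
  · simp only [Pi.add_apply, mul_add]
    exact finsum_add_distrib (hfin x g) (hfin x g')
  · simp only [Pi.smul_apply, smul_eq_mul, RingHom.id_apply, mul_finsum]
    exact finsum_congr fun i => by ring
  · change ∑ᶠ i, ρ i x * g i = c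
    have h1 (i) : ρ i x * g i = ρ i x * c := by
      by_cases hi : ρ i x = 0
      · rw [hi, zero_mul, zero_mul]
      · rw [h i (hρ i (subset_closure hi))]
    rw [finsum_congr h1, ← finsum_mul, ρ.sum_eq_one (Set.mem_univ x), one_mul]
  · intro x hx
    refine ContMDiffAt.contMDiffWithinAt ?_
    change ContMDiffAt I 𝓘(ℝ, ℝ) ∞ (fun x => ∑ᶠ i, ρ i x • g i x) x
    refine ρ.contMDiffAt_finsum fun i hi => ?_
    exact (hg i).contMDiffAt (((hU i).inter hW).mem_nhds ⟨hρ i hi, hx⟩)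

/-- The first Čech cohomology of the sheaf of smooth functions vanishes. -/
theorem exists_contMDiffOn_sub_eq [FiniteDimensional ℝ E] [IsManifold I ∞ X] [T2Space X]
    [SecondCountableTopology X] (hU : ∀ i, IsOpen (U i)) (hc : ⋃ i, U i = Set.univ)
    {h : ι → ι → X → ℝ} (hh : ∀ i j, ContMDiffOn I 𝓘(ℝ, ℝ) ∞ (h i j) (U i ∩ U j))
    (hd : ∀ i j k x, x ∈ U i → x ∈ U j → x ∈ U k → h j k x - h i k x + h i j x = 0) :
    ∃ m : ι → X → ℝ, (∀ i, ContMDiffOn I 𝓘(ℝ, ℝ) ∞ (m i) (U i)) ∧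
      ∀ i j x, x ∈ U i → x ∈ U j → m j x - m i x = h i j x := by
  obtain ⟨A, h1, h2⟩ := exists_averaging (I := I) hU hc
  -- The contracting homotopy `m_j = ∑ ρ_k h_{kj}`; by the cocycle identity the averaged differences
  -- are all equal to `h_{ij}`.
  refine ⟨fun j x => A x fun k => h k j x, fun j => h2 _ _ (hU j) fun k => hh k j,
    fun i j x hi hj => ?_⟩
  rw [← map_sub]
  refine h1 _ _ _ fun k hk => ?_
  have := hd k i j x hk hi hj
  simp only [Pi.sub_apply]
  linarith

/-- The same homotopy one degree higher, `l_{ij} = ∑ ρ_k a_{kij}`: an integral cocycle becomes a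
coboundary among smooth real cochains. -/
theorem exists_contMDiffOn_extend_eq [FiniteDimensional ℝ E] [IsManifold I ∞ X] [T2Space X]
    [SecondCountableTopology X] (hU : ∀ i, IsOpen (U i)) (hc : ⋃ i, U i = Set.univ)
    {a : CechFamily U 2} (ha : a ∈ cechCochain U 2) (hd : cechD U 2 a = 0) :
    ∃ l : ι → ι → X → ℝ, (∀ i j, ContMDiffOn I 𝓘(ℝ, ℝ) ∞ (l i j) (U i ∩ U j)) ∧
      ∀ i j k x, x ∈ U i → x ∈ U j → x ∈ U k →
        l j k x - l i k x + l i j x = a.extend ![i, j, k] x := by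
  classical
  obtain ⟨A, h1, h2⟩ := exists_averaging (I := I) hU hc
  refine ⟨fun i j x => A x fun k => if x ∈ U k then a.extend ![k, i, j] x else 0,
    fun i j => h2 _ _ ((hU i).inter (hU j)) fun k => ?_, fun i j k x hi hj hk => ?_⟩
  · refine ((contMDiffOn_extend hU ha ![k, i, j]).mono fun x hx =>
      mem_cechInter_three.2 ⟨hx.1, hx.2.1, hx.2.2⟩).congr fun x hx => ?_
    exact if_pos hx.1
  · rw [← map_sub, ← map_add]
    refine h1 _ _ _ fun n hn => ?_
    have hx : x ∈ cechInter U ![n, i, j, k] := by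
      simp [cechInter, Fin.forall_fin_succ, hn, hi, hj, hk]
    have := cechD_two_apply a _ ⟨x, hx⟩
    rw [hd] at this
    have h0 : (0 : ℤ) = a.extend ![i, j, k] x - a.extend ![n, j, k] x + a.extend ![n, i, k] x -
      a.extend ![n, i, j] x := this
    simp only [Pi.add_apply, Pi.sub_apply, hn, if_true]
    have h0' : (0 : ℝ) = a.extend ![i, j, k] x - a.extend ![n, j, k] x + a.extend ![n, i, k] x -
      a.extend ![n, i, j] x := by exact_mod_cast h0
    linarith

end CechHelpers

/-! ### Smooth real potentials of integral cone cocycles -/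

section Potential

namespace CechFamily

variable {X ι : Type*} {U : ι → Set X} {p : ℕ}

theorem extend_add (f g : CechFamily U p) (α : Fin (p + 1) → ι) (x : X) :
    (f + g).extend α x = f.extend α x + g.extend α x := by
  by_cases h : x ∈ cechInter U α
  · rw [extend_eq _ h, extend_eq _ h, extend_eq _ h]; rfl
  · rw [extend_of_notMem _ h, extend_of_notMem _ h, extend_of_notMem _ h, add_zero]

@[simp] theorem extend_zero (α : Fin (p + 1) → ι) (x : X) :
    (0 : CechFamily U p).extend α x = 0 := by
  by_cases h : x ∈ cechInter U α
  · rw [extend_eq _ h]; rfl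
  · rw [extend_of_notMem _ h]

end CechFamily

open CechFamily

variable {EM HM EN HN : Type*}
  [NormedAddCommGroup EM] [NormedSpace ℝ EM] [TopologicalSpace HM]
  [NormedAddCommGroup EN] [NormedSpace ℝ EN] [TopologicalSpace HN]
  {I : ModelWithCorners ℝ EM HM} {J : ModelWithCorners ℝ EN HN}
  {M N : Type*} [TopologicalSpace M] [ChartedSpace HM M] [TopologicalSpace N] [ChartedSpace HN N]
  {Φ : C^∞⟮I, M; J, N⟯} {ι κ : Type*} {U : ι → Set M} {V : κ → Set N} {r : ι → κ}
  {hr : ∀ i, Set.MapsTo Φ (U i) (V (r i))}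

theorem relCocycle_fst (c : relCocycle U V r Φ hr) (α : Fin 3 → ι) {x : M}
    (hx : x ∈ cechInter U α) :
    c.1.2.extend ![r (α 0), r (α 1), r (α 2)] (Φ x) =
      c.1.1.extend ![α 1, α 2] x - c.1.1.extend ![α 0, α 2] x + c.1.1.extend ![α 0, α 1] x := by
  have h : (coneD U V r Φ hr 1 c.1).1 = 0 := congrArg Prod.fst c.2.2
  have h1 : cechPullback U V r Φ hr 2 c.1.2 α ⟨x, hx⟩ - cechD U 1 c.1.1 α ⟨x, hx⟩ = 0 :=
    congrFun (congrFun h α) ⟨x, hx⟩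
  rw [cechPullback_apply, cechD_one_apply] at h1
  have h2 : r ∘ α = ![r (α 0), r (α 1), r (α 2)] := by ext k; fin_cases k <;> rfl
  rw [← h2]
  exact sub_eq_zero.1 h1

theorem relCocycle_snd (c : relCocycle U V r Φ hr) : cechD V 2 c.1.2 = 0 :=
  congrArg Prod.snd c.2.2

/-- The real functions `l` and `m` are smooth and `c = d (m, l)`. -/
structure IsPotential (l : κ → κ → N → ℝ) (m : ι → M → ℝ) (c : relCocycle U V r Φ hr) : Prop where
  contMDiffOn_fst : ∀ j j', ContMDiffOn J 𝓘(ℝ, ℝ) ∞ (l j j') (V j ∩ V j')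
  contMDiffOn_snd : ∀ i, ContMDiffOn I 𝓘(ℝ, ℝ) ∞ (m i) (U i)
  fst_eq : ∀ i j, ∀ x ∈ U i, x ∈ U j → (CechFamily.extend c.1.1 ![i, j] x : ℝ) =
    l (r i) (r j) (Φ x) - (m j x - m i x)
  snd_eq : ∀ i j k, ∀ y ∈ V i, y ∈ V j → y ∈ V k → (CechFamily.extend c.1.2 ![i, j, k] y : ℝ) =
    l j k y - l i k y + l i j y

variable {l l' : κ → κ → N → ℝ} {m m' : ι → M → ℝ} {c c' : relCocycle U V r Φ hr}

theorem eq_vec_two {ι : Type*} (α : Fin 2 → ι) : α = ![α 0, α 1] := by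
  ext k; fin_cases k <;> rfl

theorem eq_vec_three {ι : Type*} (α : Fin 3 → ι) : α = ![α 0, α 1, α 2] := by
  ext k; fin_cases k <;> rfl

theorem RelLineBundle.isChernCocycle_iff {P : RelLineBundle Φ} :
    P.IsChernCocycle U V r hr c ↔ ∃ s l m, P.L.IsFrame V s ∧ IsPotential l m c ∧
      (∀ j j', ∀ y ∈ V j ∩ V j', s j' y = phase (l j j' y) • s j y) ∧
      ∀ i, ∀ x ∈ U i, s (r i) (Φ x) = phase (m i x) • P.σ x := by
  constructor
  · rintro ⟨s, l, m, hs, hl, hsl, hm, hsm, h1, h2⟩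
    refine ⟨s, l, m, hs, ⟨hl, hm, fun i j x hi hj => ?_, fun i j k y hi hj hk => ?_⟩, hsl, hsm⟩
    · exact (congrArg _ (extend_eq _ _)).trans (h1 ![i, j] ⟨x, mem_cechInter_two.2 ⟨hi, hj⟩⟩)
    · exact (congrArg _ (extend_eq _ _)).trans
        (h2 ![i, j, k] ⟨y, mem_cechInter_three.2 ⟨hi, hj, hk⟩⟩)
  · rintro ⟨s, l, m, hs, h, hsl, hsm⟩
    refine ⟨s, l, m, hs, h.contMDiffOn_fst, hsl, h.contMDiffOn_snd, hsm, fun α x => ?_,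
      fun α y => ?_⟩
    · have hx := mem_cechInter_two.1 x.2
      rw [← h.fst_eq _ _ x hx.1 hx.2, ← eq_vec_two, extend_coe]
    · have hy := mem_cechInter_three.1 y.2
      rw [← h.snd_eq _ _ _ y hy.1 hy.2.1 hy.2.2, ← eq_vec_three, extend_coe]

namespace IsPotential

theorem add (h : IsPotential l m c) (h' : IsPotential l' m' c') :
    IsPotential (l + l') (m + m') (c + c') where
  contMDiffOn_fst j j' := (h.contMDiffOn_fst j j').add (h'.contMDiffOn_fst j j')
  contMDiffOn_snd i := (h.contMDiffOn_snd i).add (h'.contMDiffOn_snd i)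
  fst_eq i j x hi hj := by
    have h1 := h.fst_eq i j x hi hj
    have h2 := h'.fst_eq i j x hi hj
    have h3 : (c + c').1.1 = c.1.1 + c'.1.1 := rfl
    rw [h3, extend_add]
    simp only [Pi.add_apply]
    push_cast
    linarith
  snd_eq i j k y hi hj hk := by
    have h1 := h.snd_eq i j k y hi hj hk
    have h2 := h'.snd_eq i j k y hi hj hk
    have h3 : (c + c').1.2 = c.1.2 + c'.1.2 := rfl
    rw [h3, extend_add]
    simp only [Pi.add_apply]
    push_cast
    linarith

theorem apply_self (h : IsPotential l m c) {j : κ} {y : N} (hj : y ∈ V j) : l j j y = 0 := by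
  have h1 := h.snd_eq j j j y hj hj hj
  have h2 := extend_swap_three_left c.2.1.2 hj hj hj
  have h3 : c.1.2.extend ![j, j, j] y = 0 := by omega
  rw [h3] at h1
  simp at h1
  linarith

/-- Antisymmetry of `l` is forced by that of the cocycle: `a_{iji} = 0` and `l_{ii} = 0`. -/
theorem apply_swap (h : IsPotential l m c) {i j : κ} {y : N} (hi : y ∈ V i) (hj : y ∈ V j) :
    l j i y = -l i j y := by
  have h1 := h.snd_eq i j i y hi hj hi
  have h2 := extend_swap_three_left c.2.1.2 hi hj hi
  have h3 := extend_swap_three_right c.2.1.2 hj hi hi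
  have h4 : c.1.2.extend ![i, j, i] y = 0 := by omega
  rw [h4, h.apply_self hi] at h1
  push_cast at h1
  linarith

/-- Because `d ∘ d = 0` already holds for real cochains, integrality and antisymmetry of `d(m, l)`
are all that is needed for a cocycle. -/
theorem exists_of_int (hl : ∀ j j', ContMDiffOn J 𝓘(ℝ, ℝ) ∞ (l j j') (V j ∩ V j'))
    (hm : ∀ i, ContMDiffOn I 𝓘(ℝ, ℝ) ∞ (m i) (U i))
    (hs : ∀ i j, ∀ y ∈ V i, y ∈ V j → l j i y = -l i j y)
    (h1 : ∀ i j, ∀ x ∈ U i, x ∈ U j → ∃ n : ℤ, l (r i) (r j) (Φ x) - (m j x - m i x) = n)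
    (h2 : ∀ i j k, ∀ y ∈ V i, y ∈ V j → y ∈ V k → ∃ n : ℤ, l j k y - l i k y + l i j y = n) :
    ∃ c : relCocycle U V r Φ hr, IsPotential l m c := by
  have hV {i j k y} (hi : y ∈ V i) (hj : y ∈ V j) (hk : y ∈ V k) : y ∈ cechInter V ![i, j, k] :=
    mem_cechInter_three.2 ⟨hi, hj, hk⟩
  have hU {i j x} (hi : x ∈ U i) (hj : x ∈ U j) : x ∈ cechInter U ![i, j] :=
    mem_cechInter_two.2 ⟨hi, hj⟩
  obtain ⟨b, hb, hb'⟩ := exists_mem_cechCochain (U := U)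
    (fun (α : Fin 2 → ι) x => l (r (α 0)) (r (α 1)) (Φ x) - (m (α 1) x - m (α 0) x))
    (fun α => by
      refine ContinuousOn.sub ?_ (ContinuousOn.sub ?_ ?_)
      · exact (hl _ _).continuousOn.comp Φ.contMDiff.continuous.continuousOn fun x hx =>
          ⟨hr _ (mem_cechInter_two.1 hx).1, hr _ (mem_cechInter_two.1 hx).2⟩
      · exact (hm _).continuousOn.mono fun x hx => (mem_cechInter_two.1 hx).2
      · exact (hm _).continuousOn.mono fun x hx => (mem_cechInter_two.1 hx).1)
    (fun α x hx => h1 _ _ x (mem_cechInter_two.1 hx).1 (mem_cechInter_two.1 hx).2)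
    (fun k α x hx => by
      obtain ⟨hx0, hx1⟩ := mem_cechInter_two.1 hx
      have := hs _ _ (Φ x) (hr _ hx0) (hr _ hx1)
      fin_cases k
      simp [this]
      ring)
  obtain ⟨a, ha, ha'⟩ := exists_mem_cechCochain (U := V)
    (fun (α : Fin 3 → κ) y => l (α 1) (α 2) y - l (α 0) (α 2) y + l (α 0) (α 1) y)
    (fun α => by
      refine ContinuousOn.add (ContinuousOn.sub ?_ ?_) ?_
      · exact (hl _ _).continuousOn.mono fun y hy => (mem_cechInter_three.1 hy).2
      · exact (hl _ _).continuousOn.mono fun y hy =>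
          ⟨(mem_cechInter_three.1 hy).1, (mem_cechInter_three.1 hy).2.2⟩
      · exact (hl _ _).continuousOn.mono fun y hy =>
          ⟨(mem_cechInter_three.1 hy).1, (mem_cechInter_three.1 hy).2.1⟩)
    (fun α y hy => h2 _ _ _ y (mem_cechInter_three.1 hy).1 (mem_cechInter_three.1 hy).2.1
      (mem_cechInter_three.1 hy).2.2)
    (fun k α y hy => by
      obtain ⟨hy0, hy1, hy2⟩ := mem_cechInter_three.1 hy
      fin_cases k
      · have := hs _ _ y hy0 hy1
        have e : (Equiv.swap (0 : Fin 3) 1) 2 = 2 := by decide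
        simp [this, e]
        ring
      · have := hs _ _ y hy1 hy2
        have e : (Equiv.swap (1 : Fin 3) 2) 0 = 0 := by decide
        simp [this, e]
        ring)
  have hb2 (i j x) (hi : x ∈ U i) (hj : x ∈ U j) :
      (b.extend ![i, j] x : ℝ) = l (r i) (r j) (Φ x) - (m j x - m i x) := hb' _ x (hU hi hj)
  have ha2 (i j k y) (hi : y ∈ V i) (hj : y ∈ V j) (hk : y ∈ V k) :
      (a.extend ![i, j, k] y : ℝ) = l j k y - l i k y + l i j y := ha' _ y (hV hi hj hk)
  refine ⟨⟨(b, a), ⟨hb, ha⟩, ?_⟩, hl, hm, hb2, ha2⟩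
  refine Prod.ext ?_ ?_
  · funext α x
    change cechPullback U V r Φ hr 2 a α x - cechD U 1 b α x = 0
    rw [cechPullback_apply, cechD_one_apply, eq_vec_three (r ∘ α), ← @Int.cast_inj ℝ]
    obtain ⟨hx0, hx1, hx2⟩ := mem_cechInter_three.1 x.2
    push_cast
    rw [hb2 _ _ _ hx0 hx1, hb2 _ _ _ hx0 hx2, hb2 _ _ _ hx1 hx2,
      ha2 ((r ∘ α) 0) ((r ∘ α) 1) ((r ∘ α) 2) _ (hr _ hx0) (hr _ hx1) (hr _ hx2)]
    simp only [Function.comp]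
    ring
  · funext α y
    change cechD V 2 a α y = 0
    have hy k : y.1 ∈ V (α k) := Set.mem_iInter.1 y.2 k
    rw [cechD_two_apply, ← @Int.cast_inj ℝ]
    push_cast
    rw [ha2 _ _ _ _ (hy 1) (hy 2) (hy 3), ha2 _ _ _ _ (hy 0) (hy 2) (hy 3),
      ha2 _ _ _ _ (hy 0) (hy 1) (hy 3), ha2 _ _ _ _ (hy 0) (hy 1) (hy 2)]
    ring

/-- Here `k` is the logarithm of a change of frame. The differences `a = l' - l - dk` and `b = m' -
m - Φ^*k` are integral, and `d(b, a) = c' - c` because the contributions of `k` cancel. -/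
theorem mk_eq_mk (h : IsPotential l m c) (h' : IsPotential l' m' c') {k : κ → N → ℝ}
    (hk : ∀ j, ContMDiffOn J 𝓘(ℝ, ℝ) ∞ (k j) (V j))
    (h1 : ∀ j j', ∀ y ∈ V j, y ∈ V j' → ∃ n : ℤ, l' j j' y + k j y - (k j' y + l j j' y) = n)
    (h2 : ∀ i, ∀ x ∈ U i, ∃ n : ℤ, m' i x - (k (r i) (Φ x) + m i x) = n) :
    (c : RelH2 U V r Φ hr) = c' := by
  have hU {i j x} (hi : x ∈ U i) (hj : x ∈ U j) : x ∈ cechInter U ![i, j] :=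
    mem_cechInter_two.2 ⟨hi, hj⟩
  obtain ⟨b, hb, hb'⟩ := exists_mem_cechCochain (U := U)
    (fun (α : Fin 1 → ι) x => m' (α 0) x - (k (r (α 0)) (Φ x) + m (α 0) x))
    (fun α => by
      refine ContinuousOn.mono (s := U (α 0)) ?_ (Set.iInter_subset _ 0)
      refine (h'.contMDiffOn_snd _).continuousOn.sub (ContinuousOn.add ?_
        (h.contMDiffOn_snd _).continuousOn)
      exact (hk _).continuousOn.comp Φ.contMDiff.continuous.continuousOn (hr _))
    (fun α x hx => h2 _ x (Set.mem_iInter.1 hx 0)) (fun k => k.elim0)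
  obtain ⟨a, ha, ha'⟩ := exists_mem_cechCochain (U := V)
    (fun (α : Fin 2 → κ) y => l' (α 0) (α 1) y + k (α 0) y - (k (α 1) y + l (α 0) (α 1) y))
    (fun α => by
      have e : cechInter V α = V (α 0) ∩ V (α 1) := Set.ext fun x => mem_cechInter_two
      rw [e]
      exact ((h'.contMDiffOn_fst _ _).continuousOn.add
        ((hk _).continuousOn.mono Set.inter_subset_left)).sub
        (((hk _).continuousOn.mono Set.inter_subset_right).add
        (h.contMDiffOn_fst _ _).continuousOn))
    (fun α y hy => h1 _ _ y (mem_cechInter_two.1 hy).1 (mem_cechInter_two.1 hy).2)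
    (fun k α y hy => by
      obtain ⟨hy0, hy1⟩ := mem_cechInter_two.1 hy
      have := h.apply_swap hy0 hy1
      have := h'.apply_swap hy0 hy1
      fin_cases k
      simp [*]
      ring)
  have hb2 (i x) (hi : x ∈ U i) :
      (b.extend ![i] x : ℝ) = m' i x - (k (r i) (Φ x) + m i x) :=
    hb' _ x (mem_cechInter_one.2 hi)
  have ha2 (i j y) (hi : y ∈ V i) (hj : y ∈ V j) :
      (a.extend ![i, j] y : ℝ) = l' i j y + k i y - (k j y + l i j y) :=
    ha' _ y (mem_cechInter_two.2 ⟨hi, hj⟩)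
  refine QuotientAddGroup.eq.2 (AddSubgroup.mem_addSubgroupOf.2 ⟨(b, a), ⟨hb, ha⟩, ?_⟩)
  refine Prod.ext ?_ ?_
  · funext α x
    change cechPullback U V r Φ hr 1 a α x - cechD U 0 b α x = -c.1.1 α x + c'.1.1 α x
    obtain ⟨hx0, hx1⟩ := mem_cechInter_two.1 x.2
    have e1 := h.fst_eq _ _ _ hx0 hx1
    have e2 := h'.fst_eq _ _ _ hx0 hx1
    rw [← eq_vec_two, extend_coe] at e1 e2
    rw [cechPullback_apply, cechD_zero_apply, eq_vec_two (r ∘ α), ← @Int.cast_inj ℝ]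
    push_cast
    rw [e1, e2, hb2 _ _ hx0, hb2 _ _ hx1, ha2 ((r ∘ α) 0) ((r ∘ α) 1) _ (hr _ hx0) (hr _ hx1)]
    simp only [Function.comp]
    ring
  · funext α y
    change cechD V 1 a α y = -c.1.2 α y + c'.1.2 α y
    obtain ⟨hy0, hy1, hy2⟩ := mem_cechInter_three.1 y.2
    have e1 := h.snd_eq _ _ _ _ hy0 hy1 hy2
    have e2 := h'.snd_eq _ _ _ _ hy0 hy1 hy2
    rw [← eq_vec_three, extend_coe] at e1 e2
    rw [cechD_one_apply, ← @Int.cast_inj ℝ]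
    push_cast
    rw [e1, e2, ha2 _ _ _ hy0 hy1, ha2 _ _ _ hy0 hy2, ha2 _ _ _ hy1 hy2]
    ring

/-- An integral coboundary is absorbed by adding integers to `l` and `m`, which does not affect
their exponentials. -/
theorem exists_of_mk_eq_mk (hU : ∀ i, IsOpen (U i)) (hV : ∀ j, IsOpen (V j))
    (h : IsPotential l m c) (hc : (c : RelH2 U V r Φ hr) = c') :
    ∃ l' m', IsPotential l' m' c' ∧ (∀ j j' y, phase (l' j j' y) = phase (l j j' y)) ∧
      ∀ i x, phase (m' i x) = phase (m i x) := by
  obtain ⟨⟨b, a⟩, ⟨hb, ha⟩, hd⟩ := AddSubgroup.mem_addSubgroupOf.1 (QuotientAddGroup.eq.1 hc)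
  refine ⟨fun j j' y => l j j' y + a.extend ![j, j'] y, fun i x => m i x + b.extend ![i] x,
    ⟨fun j j' => ?_, fun i => ?_, fun i j x hi hj => ?_, fun i j k y hi hj hk => ?_⟩,
    fun j j' y => ?_, fun i x => ?_⟩
  · refine (h.contMDiffOn_fst j j').add ((contMDiffOn_extend hV ha _).mono fun y hy => ?_)
    exact mem_cechInter_two.2 hy
  · refine (h.contMDiffOn_snd i).add ((contMDiffOn_extend hU hb _).mono fun x hx => ?_)
    exact mem_cechInter_one.2 hx
  · have hx : x ∈ cechInter U ![i, j] := mem_cechInter_two.2 ⟨hi, hj⟩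
    have e : cechPullback U V r Φ hr 1 a ![i, j] ⟨x, hx⟩ - cechD U 0 b ![i, j] ⟨x, hx⟩ =
      -c.1.1 ![i, j] ⟨x, hx⟩ + c'.1.1 ![i, j] ⟨x, hx⟩ :=
      congrFun (congrFun (congrArg Prod.fst hd) ![i, j]) ⟨x, hx⟩
    rw [cechPullback_apply, cechD_zero_apply, eq_vec_two (r ∘ _), ← @Int.cast_inj ℝ,
      ← extend_coe c.1.1, ← extend_coe c'.1.1] at e
    push_cast at e
    rw [h.fst_eq _ _ _ hi hj] at e
    simp only [Matrix.cons_val_zero, Matrix.cons_val_one, Function.comp] at e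
    linarith
  · have hy : y ∈ cechInter V ![i, j, k] := mem_cechInter_three.2 ⟨hi, hj, hk⟩
    have e : cechD V 1 a ![i, j, k] ⟨y, hy⟩ =
      -c.1.2 ![i, j, k] ⟨y, hy⟩ + c'.1.2 ![i, j, k] ⟨y, hy⟩ :=
      congrFun (congrFun (congrArg Prod.snd hd) ![i, j, k]) ⟨y, hy⟩
    rw [cechD_one_apply, ← @Int.cast_inj ℝ, ← extend_coe c.1.2, ← extend_coe c'.1.2] at e
    push_cast at e
    rw [h.snd_eq _ _ _ _ hi hj hk] at e
    linarith
  · rw [phase_add, phase_intCast, mul_one]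
  · rw [phase_add, phase_intCast, mul_one]

/-- Write `c = (b, a)`. Fineness on `N` solves `dl = a`; then `Φ^*l - b` is a smooth cocycle by the
cone condition `Φ^*a = db`, and fineness on `M` writes it as `dm`. -/
theorem exists_of_cocycle [FiniteDimensional ℝ EM] [IsManifold I ∞ M] [T2Space M]
    [SecondCountableTopology M] [FiniteDimensional ℝ EN] [IsManifold J ∞ N] [T2Space N]
    [SecondCountableTopology N] (hU : IsGoodCover U) (hV : IsGoodCover V)
    (c : relCocycle U V r Φ hr) : ∃ l m, IsPotential l m c := by
  obtain ⟨l, hl, hd⟩ := exists_contMDiffOn_extend_eq (I := J) hV.isOpen hV.iUnion_eq c.2.1.2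
    (relCocycle_snd c)
  have h1 (i j) : ContMDiffOn I 𝓘(ℝ, ℝ) ∞
      (fun x => l (r i) (r j) (Φ x) - c.1.1.extend ![i, j] x) (U i ∩ U j) := by
    refine ContMDiffOn.sub ((hl _ _).comp Φ.contMDiff.contMDiffOn fun x hx =>
      ⟨hr _ hx.1, hr _ hx.2⟩) ((contMDiffOn_extend hU.isOpen c.2.1.1 _).mono fun x hx => ?_)
    exact mem_cechInter_two.2 hx
  obtain ⟨m, hm, hd'⟩ := exists_contMDiffOn_sub_eq hU.isOpen hU.iUnion_eq h1
    fun i j k x hi hj hk => by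
      have e1 := hd _ _ _ _ (hr _ hi) (hr _ hj) (hr _ hk)
      have e2 : c.1.2.extend ![r i, r j, r k] (Φ x) = _ :=
        relCocycle_fst c ![i, j, k] (mem_cechInter_three.2 ⟨hi, hj, hk⟩)
      simp only [Matrix.cons_val_zero, Matrix.cons_val_one, Matrix.cons_val] at e2
      rw [e2] at e1
      push_cast at e1
      linarith
  exact ⟨l, m, hl, hm, fun i j x hi hj => by linarith [hd' i j x hi hj],
    fun i j k y hi hj hk => (hd i j k y hi hj hk).symm⟩

end IsPotential

end Potential

/-! ### The relative Chern class -/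

section ChernClass

theorem exists_int_of_phase_smul {E : Type*} [NormedAddCommGroup E] [NormedSpace ℂ E] {v : E}
    {s t : ℝ} (hv : ‖v‖ = 1) (h : phase s • v = phase t • v) : ∃ n : ℤ, s - t = n :=
  (phase_eq_phase_iff s t).1 (smul_left_injective ℂ (norm_ne_zero_iff.1 (by simp [hv])) h)

theorem eq_phase_smul_iff {E : Type*} [AddCommGroup E] [Module ℂ E] {v w : E} {t : ℝ} :
    v = phase t • w ↔ w = phase (-t) • v := by
  constructor <;> rintro rfl <;> rw [smul_smul, ← phase_add] <;> simp

variable {EM HM EN HN : Type*}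
  [NormedAddCommGroup EM] [NormedSpace ℝ EM] [TopologicalSpace HM]
  [NormedAddCommGroup EN] [NormedSpace ℝ EN] [TopologicalSpace HN]
  {I : ModelWithCorners ℝ EM HM} {J : ModelWithCorners ℝ EN HN}
  {M N : Type*} [TopologicalSpace M] [ChartedSpace HM M] [TopologicalSpace N] [ChartedSpace HN N]
  {Φ : C^∞⟮I, M; J, N⟯} {ι κ : Type*} {U : ι → Set M} {V : κ → Set N} {r : ι → κ}
  {hr : ∀ i, Set.MapsTo Φ (U i) (V (r i))} {c c' : relCocycle U V r Φ hr}

namespace RelLineBundle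

open HermitianLineBundle

variable {P Q R : RelLineBundle Φ}

theorem IsChernCocycle.of_iso (hP : P.IsChernCocycle U V r hr c) (h : P.Iso Q) :
    Q.IsChernCocycle U V r hr c := by
  obtain ⟨s, l, m, hs, hl, h1, h2⟩ := isChernCocycle_iff.1 hP
  obtain ⟨t, ht, h3, h4⟩ := h.exists_frame hs
  exact isChernCocycle_iff.2 ⟨t, l, m, ht, hl, fun j j' y hy => h3 _ _ _ _ (h1 j j' y hy),
    fun i x hx => eq_phase_smul_iff.2 (h4 _ _ _ (eq_phase_smul_iff.1 (h2 i x hx)))⟩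

/-- In the tensor product frame the phases multiply, so the potentials add. -/
theorem IsChernCocycle.add (hP : P.IsChernCocycle U V r hr c) (hQ : Q.IsChernCocycle U V r hr c')
    (h : IsTensorProduct P Q R) : R.IsChernCocycle U V r hr (c + c') := by
  obtain ⟨s, l, m, hs, hl, h1, h2⟩ := isChernCocycle_iff.1 hP
  obtain ⟨t, l', m', ht, hl', h1', h2'⟩ := isChernCocycle_iff.1 hQ
  obtain ⟨u, hu, h3, h4⟩ := h.exists_frame hs ht
  refine isChernCocycle_iff.2 ⟨u, _, _, hu, hl.add hl', fun j j' y hy => ?_, fun i x hx => ?_⟩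
  · rw [h3 _ _ _ _ _ (h1 j j' y hy) (h1' j j' y hy), ← phase_add]
    rfl
  · rw [eq_phase_smul_iff, h4 _ _ _ _ (eq_phase_smul_iff.1 (h2 i x hx))
      (eq_phase_smul_iff.1 (h2' i x hx)), ← phase_add, ← neg_add]
    rfl

theorem IsChernCocycle.congr (hU : IsGoodCover U) (hV : IsGoodCover V)
    (hP : P.IsChernCocycle U V r hr c) (h : (c : RelH2 U V r Φ hr) = c') :
    P.IsChernCocycle U V r hr c' := by
  obtain ⟨s, l, m, hs, hl, h1, h2⟩ := isChernCocycle_iff.1 hP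
  obtain ⟨l', m', hl', h3, h4⟩ := hl.exists_of_mk_eq_mk hU.isOpen hV.isOpen h
  exact isChernCocycle_iff.2 ⟨s, l', m', hs, hl', fun j j' y hy => by rw [h3, h1 j j' y hy],
    fun i x hx => by rw [h4, h2 i x hx]⟩

/-- Two frames differ over each `V_j` by a unitary function, whose logarithm `k_j` relates the two
potentials up to integers. -/
theorem IsChernCocycle.mk_eq_mk [LocallyPathConnectedSpace N] (hV : IsGoodCover V)
    (hc : P.IsChernCocycle U V r hr c) (hc' : P.IsChernCocycle U V r hr c') :
    (c : RelH2 U V r Φ hr) = c' := by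
  obtain ⟨s, l, m, hs, hl, h1, h2⟩ := isChernCocycle_iff.1 hc
  obtain ⟨s', l', m', hs', hl', h1', h2'⟩ := isChernCocycle_iff.1 hc'
  choose k hk hk' using fun j => exists_contMDiffOn_phase_eq (I := J) (hV.isOpen j)
    (hV.contractibleSpace j) (u := fun y => inner ℂ (s j y) (s' j y))
    (fun y hy => contMDiffWithinAt_inner ((hs j).1 y hy) ((hs' j).1 y hy))
    fun y hy => (norm_inner_eq ((hs j).2 y hy) _).trans ((hs' j).2 y hy)
  have e (j y) (hy : y ∈ V j) : s' j y = phase (k j y) • s j y := by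
    rw [← hk' j y hy, inner_smul_eq _ ((hs j).2 y hy)]
  refine hl.mk_eq_mk hl' hk (fun j j' y hj hj' => exists_int_of_phase_smul ((hs j).2 y hj) ?_)
    fun i x hx => exists_int_of_phase_smul (P.norm_σ x) ?_
  · rw [phase_add, mul_smul, ← e j y hj, ← h1' j j' y ⟨hj, hj'⟩, phase_add, mul_smul,
      ← h1 j j' y ⟨hj, hj'⟩, e j' y hj']
  · rw [phase_add, mul_smul, ← h2 i x hx, ← h2' i x hx, e _ _ (hr i hx)]

theorem exists_isChernCocycle [LocallyPathConnectedSpace M] [LocallyPathConnectedSpace N]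
    [FiniteDimensional ℝ EN] [IsManifold J ∞ N] [T2Space N] [SecondCountableTopology N]
    (hU : IsGoodCover U) (hV : IsGoodCover V) (P : RelLineBundle Φ) :
    ∃ c, P.IsChernCocycle U V r hr c := by
  classical
  obtain ⟨c, hc⟩ := exists_hasCoords hV P
  have hc' := hc.isCoords hV
  obtain ⟨s, hs, h1, h2⟩ := hc
  choose L hL hL' using fun j j' => exists_contMDiffOn_phase_eq ((hV.isOpen j).inter (hV.isOpen j'))
    (hV.contractibleSpace_inter j j') (hc'.contMDiffOn_fst j j') (hc'.norm_fst j j')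
  choose w hw hw' using fun i => exists_contMDiffOn_phase_eq (hU.isOpen i)
    (hU.contractibleSpace i) ((hc'.contMDiffOn_snd (r i)).mono (hr i))
    fun x hx => hc'.norm_snd (r i) x (hr i hx)
  -- Cochains must be antisymmetric, so logarithms are chosen only for `j < j'` and extended by
  -- antisymmetry, with zero on the diagonal.
  let _ : LinearOrder κ := linearOrderOfSTO WellOrderingRel
  let l : κ → κ → N → ℝ := fun j j' y => if j < j' then L j j' y else if j' < j then -L j' j y else 0
  have hl (j j') : ContMDiffOn J 𝓘(ℝ, ℝ) ∞ (l j j') (V j ∩ V j') := by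
    simp only [l]
    split_ifs
    · exact hL j j'
    · exact Set.inter_comm (V j) _ ▸ (hL j' j).neg
    · exact contMDiffOn_const
  have hls (i j y) : l j i y = -l i j y := by
    rcases lt_trichotomy i j with h | rfl | h
    · simp [l, h, h.not_gt]
    · simp [l]
    · simp [l, h, h.not_gt]
  have h1' (j j') (y) (hy : y ∈ V j ∩ V j') : s j' y = phase (l j j' y) • s j y := by
    rcases lt_trichotomy j j' with h | rfl | h
    · simp only [l, h, if_true]
      rw [← hL' j j' y hy, h1 j j' y hy]
    · simp [l]
    · simp only [l, h, h.not_gt, if_true, if_false]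
      rw [← eq_phase_smul_iff, ← hL' j' j y hy.symm, h1 j' j y hy.symm]
  -- The sign appears because `w` is the logarithm of `σ / s`, whereas `m` is that of `s / σ`.
  have h2' (i x) (hx : x ∈ U i) : s (r i) (Φ x) = phase (-w i x) • P.σ x := by
    rw [← eq_phase_smul_iff, ← hw' i x hx, h2 _ _ (hr i hx)]
  obtain ⟨c, hc⟩ := IsPotential.exists_of_int (Φ := Φ) (hr := hr) hl (m := fun i x => -w i x)
    (fun i => (hw i).neg) (fun i j y _ _ => hls i j y)
    (fun i j x hi hj => by
      obtain ⟨n, hn⟩ := exists_int_of_phase_smul (s := l (r i) (r j) (Φ x) + -w i x)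
        (t := -w j x) (P.norm_σ x) (by
          rw [phase_add, mul_smul, ← h2' i x hi, ← h2' j x hj, h1' _ _ _ ⟨hr i hi, hr j hj⟩])
      exact ⟨n, by linarith⟩)
    fun i j k y hi hj hk => by
      obtain ⟨n, hn⟩ := exists_int_of_phase_smul (s := l j k y + l i j y) (t := l i k y)
        ((hs i).2 y hi) (by
          rw [phase_add, mul_smul, ← h1' i j y ⟨hi, hj⟩, ← h1' j k y ⟨hj, hk⟩,
            h1' i k y ⟨hi, hk⟩])
      exact ⟨n, by linarith⟩
  exact ⟨c, isChernCocycle_iff.2 ⟨s, l, _, hs, hc, h1', h2'⟩⟩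

/-- Integrality of `dl` makes the exponentials of `l` transition functions, and integrality of `Φ^*l
- dm` makes the local descriptions of `σ` agree. -/
theorem _root_.IsPotential.exists_isChernCocycle {l : κ → κ → N → ℝ} {m : ι → M → ℝ}
    (hU : IsGoodCover U) (hV : IsGoodCover V) (h : IsPotential l m c) :
    ∃ P : RelLineBundle Φ, P.IsChernCocycle U V r hr c := by
  choose i hi using fun x => Set.mem_iUnion.1 (hU.iUnion_eq.superset (Set.mem_univ x))
  -- Logarithm of the coordinate of `σ` in the frame `s_j`, computed through `s_{r(i)} = exp(2π√-1
  -- m_i) σ`; changing `i` changes it by an integer.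
  let W : κ → ι → M → ℝ := fun j i x => l j (r i) (Φ x) - m i x
  have hW (j i i' x) (hj : Φ x ∈ V j) (hx : x ∈ U i) (hx' : x ∈ U i') :
      phase (W j i x) = phase (W j i' x) := by
    have e1 := h.fst_eq i i' x hx hx'
    have e2 := h.snd_eq j (r i) (r i') _ hj (hr i hx) (hr i' hx')
    refine (phase_eq_phase_iff _ _).2
      ⟨c.1.2.extend ![j, r i, r i'] (Φ x) - c.1.1.extend ![i, i'] x, ?_⟩
    push_cast
    simp only [W]
    linarith
  obtain ⟨P, s, hs, h1, h2⟩ := IsCoords.exists_hasCoords (J := J) (I := I) (Φ := Φ) (V := V)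
    (c := (fun j j' y => phase (l j j' y), fun j x => phase (W j (i x) x))) hV
    { contMDiffOn_fst j j' := contDiff_phase.contMDiff.comp_contMDiffOn (h.contMDiffOn_fst j j')
      norm_fst j j' y hy := norm_phase _
      fst_self j y hy := by simp [h.apply_self hy]
      fst_mul i j k y hy := by
        have e := h.snd_eq i j k y hy.1.1 hy.1.2 hy.2
        rw [← phase_add]
        exact (phase_eq_phase_iff _ _).2 ⟨c.1.2.extend ![i, j, k] y, by linarith⟩
      contMDiffOn_snd j x hx := by
        have ho : IsOpen (Φ ⁻¹' V j ∩ U (i x)) :=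
          ((hV.isOpen j).preimage Φ.contMDiff.continuous).inter (hU.isOpen _)
        have h3 : ContMDiffOn I 𝓘(ℝ, ℝ) ∞ (W j (i x)) (Φ ⁻¹' V j ∩ U (i x)) :=
          ((h.contMDiffOn_fst _ _).comp Φ.contMDiff.contMDiffOn fun z hz =>
            ⟨hz.1, hr _ hz.2⟩).sub ((h.contMDiffOn_snd _).mono Set.inter_subset_right)
        have hn := ho.mem_nhds ⟨hx, hi x⟩
        refine ((contDiff_phase.contMDiff.comp_contMDiffOn h3).contMDiffAt hn
          |>.congr_of_eventuallyEq ?_).contMDiffWithinAt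
        filter_upwards [hn] with z hz
        exact hW j _ _ z hz.1 (hi z) hz.2
      norm_snd j x hx := norm_phase _
      snd_eq j j' x hx := by
        have e := h.snd_eq j j' (r (i x)) _ hx.1 hx.2 (hr _ (hi x))
        rw [← phase_add]
        refine (phase_eq_phase_iff _ _).2 ⟨-c.1.2.extend ![j, j', r (i x)] (Φ x), ?_⟩
        push_cast
        simp only [W]
        linarith }
  refine ⟨P, isChernCocycle_iff.2 ⟨s, l, m, hs, h, h1, fun i' x hx => ?_⟩⟩
  rw [eq_phase_smul_iff, h2 _ _ (hr i' hx)]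
  change phase (W (r i') (i x) x) • _ = _
  rw [hW _ _ i' _ (hr i' hx) (hi x) hx]
  simp [W, h.apply_self (hr i' hx)]

theorem IsInPicZero.isChernCocycle (h : P.IsInPicZero) : P.IsChernCocycle U V r hr 0 := by
  obtain ⟨τ, hτ, k, hk, hkτ⟩ := h
  refine isChernCocycle_iff.2 ⟨fun _ => τ, 0, fun _ => k, fun j => hτ.mono (Set.subset_univ _),
    ⟨fun _ _ => contMDiffOn_const, fun _ => hk.contMDiffOn, fun i j x _ _ => ?_,
      fun i j k y _ _ _ => ?_⟩, fun j j' y _ => ?_, fun i x _ => hkτ x⟩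
  · simp
  · simp
  · simp

/-- When the cocycle vanishes, `l = dk` with `k` smooth; then `exp(-2π√-1 k_j) s_j` glue to a
section `τ` and `m_i - Φ^*k_{r(i)}` to a logarithm of `Φ^*τ/σ`. -/
theorem IsChernCocycle.isInPicZero [FiniteDimensional ℝ EN] [IsManifold J ∞ N] [T2Space N]
    [SecondCountableTopology N] (hU : IsGoodCover U) (hV : IsGoodCover V)
    (h : P.IsChernCocycle U V r hr 0) : P.IsInPicZero := by
  obtain ⟨s, l, m, hs, hl, h1, h2⟩ := isChernCocycle_iff.1 h
  choose i hi using fun x => Set.mem_iUnion.1 (hU.iUnion_eq.superset (Set.mem_univ x))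
  choose j hj using fun y => Set.mem_iUnion.1 (hV.iUnion_eq.superset (Set.mem_univ y))
  obtain ⟨k, hk, hkl⟩ := exists_contMDiffOn_sub_eq hV.isOpen hV.iUnion_eq hl.contMDiffOn_fst
    fun i j k y hi hj hk => by simpa using (hl.snd_eq i j k y hi hj hk).symm
  have hτ (n n' y) (hn : y ∈ V n) (hn' : y ∈ V n') :
      phase (-k n y) • s n y = phase (-k n' y) • s n' y := by
    rw [h1 n n' y ⟨hn, hn'⟩, smul_smul, ← phase_add, ← hkl n n' y hn hn']
    ring_nf
  have hm (n n' x) (hn : x ∈ U n) (hn' : x ∈ U n') :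
      m n x - k (r n) (Φ x) = m n' x - k (r n') (Φ x) := by
    have e1 := hkl _ _ _ (hr n hn) (hr n' hn')
    have e2 := hl.fst_eq n n' x hn hn'
    simp at e2
    linarith
  refine ⟨fun y => phase (-k (j y) y) • s (j y) y, ⟨fun y _ => ?_, fun y _ => ?_⟩,
    fun x => m (i x) x - k (r (i x)) (Φ x), fun x => ?_, fun x => ?_⟩
  · have hn := (hV.isOpen (j y)).mem_nhds (hj y)
    have h3 : ContMDiffOn J (J.prod 𝓘(ℝ, ℂ)) ∞ (fun z => (⟨z, phase (-k (j y) z) • s (j y) z⟩ :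
        TotalSpace ℂ P.L.Fiber)) (V (j y)) := fun z hz => contMDiffWithinAt_smul (b := id)
      (contDiff_phase.contMDiff.comp_contMDiffOn (hk (j y)).neg z hz) ((hs (j y)).1 z hz)
    refine ((h3.contMDiffAt hn).congr_of_eventuallyEq ?_).contMDiffWithinAt
    filter_upwards [hn] with z hz
    rw [hτ _ _ z (hj z) hz]
  · rw [norm_smul, norm_phase, (hs _).2 _ (hj y), one_mul]
  · have hn := (hU.isOpen (i x)).mem_nhds (hi x)
    have h3 : ContMDiffOn I 𝓘(ℝ, ℝ) ∞ (fun z => m (i x) z - k (r (i x)) (Φ z)) (U (i x)) :=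
      (hl.contMDiffOn_snd _).sub ((hk _).comp Φ.contMDiff.contMDiffOn (hr _))
    refine (h3.contMDiffAt hn).congr_of_eventuallyEq ?_
    filter_upwards [hn] with z hz
    exact hm _ _ z (hi z) hz
  · change phase (-k (j (Φ x)) (Φ x)) • s (j (Φ x)) (Φ x) = _
    rw [hτ _ (r (i x)) _ (hj _) (hr _ (hi x)), h2 _ _ (hi x), smul_smul, ← phase_add]
    ring_nf

end RelLineBundle

end ChernClass

/-! ### The main theorem -/

theorem mainTheorem3 {p q : ℕ}
    {M : Type*} [TopologicalSpace M] [T2Space M] [SecondCountableTopology M]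
    [ChartedSpace (EuclideanSpace ℝ (Fin p)) M] [IsManifold (𝓡 p) ∞ M]
    {N : Type*} [TopologicalSpace N] [T2Space N] [SecondCountableTopology N]
    [ChartedSpace (EuclideanSpace ℝ (Fin q)) N] [IsManifold (𝓡 q) ∞ N]
    (Φ : C^∞⟮𝓡 p, M; 𝓡 q, N⟯)
    {ι κ : Type*} (U : ι → Set M) (V : κ → Set N) (hU : IsGoodCover U) (hV : IsGoodCover V)
    (r : ι → κ) (hr : ∀ i, Set.MapsTo Φ (U i) (V (r i))) :
    -- the tensor product makes `Pic(Φ)` an abelian group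
    ∃ _ : CommGroup (RelPic Φ),
      (∀ P Q R : RelLineBundle Φ,
        (⟦P⟧ * ⟦Q⟧ : RelPic Φ) = ⟦R⟧ ↔ RelLineBundle.IsTensorProduct P Q R) ∧
      -- `Pic₀(Φ)` is a subgroup
      ∃ Pic₀ : Subgroup (RelPic Φ),
        (∀ P : RelLineBundle Φ, (⟦P⟧ : RelPic Φ) ∈ Pic₀ ↔ P.IsInPicZero) ∧
        -- the relative Chern class is a well-defined surjective homomorphism with kernel `Pic₀(Φ)`
        ∃ χ : RelPic Φ →* Multiplicative (RelH2 U V r Φ hr),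
          (∀ (P : RelLineBundle Φ) (c : relCocycle U V r Φ hr),
            χ ⟦P⟧ = Multiplicative.ofAdd (c : RelH2 U V r Φ hr) ↔
              P.IsChernCocycle U V r hr c) ∧
          χ.ker = Pic₀ ∧
          Function.Surjective χ ∧
          -- the fibers of `(σ, L) ↦ χ(σ, L)` are the equivalence classes
          ∀ P Q : RelLineBundle Φ, χ ⟦P⟧ = χ ⟦Q⟧ ↔ P.Equivalent Q := by
  have : LocallyPathConnectedSpace M :=
    ChartedSpace.locallyPathConnectedSpace (EuclideanSpace ℝ (Fin p)) M
  have : LocallyPathConnectedSpace N :=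
    ChartedSpace.locallyPathConnectedSpace (EuclideanSpace ℝ (Fin q)) N
  obtain ⟨_, hG⟩ := RelLineBundle.exists_commGroup_relPic hV Φ
  choose C hC using fun P : RelLineBundle Φ =>
    P.exists_isChernCocycle (hr := hr) hU hV
  -- The representing cocycles of a bundle form exactly one cohomology class, so an arbitrary choice
  -- `C` defines `χ`.
  have hiff (P : RelLineBundle Φ) (c : relCocycle U V r Φ hr) :
      (C P : RelH2 U V r Φ hr) = c ↔ P.IsChernCocycle U V r hr c :=
    ⟨fun h => (hC P).congr hU hV h, fun h => (hC P).mk_eq_mk hV h⟩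
  let f : RelPic Φ → Multiplicative (RelH2 U V r Φ hr) :=
    Quotient.lift (fun P => Multiplicative.ofAdd (C P : RelH2 U V r Φ hr)) fun P Q h =>
      congrArg Multiplicative.ofAdd ((hiff P (C Q)).2 ((hC Q).of_iso ((RelLineBundle.setoid Φ).symm h)))
  have hf (P : RelLineBundle Φ) (c : relCocycle U V r Φ hr) :
      f ⟦P⟧ = Multiplicative.ofAdd (c : RelH2 U V r Φ hr) ↔ P.IsChernCocycle U V r hr c :=
    Multiplicative.ofAdd.injective.eq_iff.trans (hiff P c)
  let χ : RelPic Φ →* Multiplicative (RelH2 U V r Φ hr) := MonoidHom.mk' f fun a b => by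
    induction a, b using Quotient.inductionOn₂ with | _ P Q
    obtain ⟨R, hR⟩ := Quotient.exists_rep (⟦P⟧ * ⟦Q⟧ : RelPic Φ)
    rw [← hR]
    exact (hf R (C P + C Q)).2 ((hC P).add (hC Q) ((hG P Q R).1 hR.symm))
  have hχ (P : RelLineBundle Φ) : (⟦P⟧ : RelPic Φ) ∈ χ.ker ↔ P.IsInPicZero :=
    (hf P 0).trans
      ⟨fun h => h.isInPicZero hU hV, fun h => h.isChernCocycle⟩
  -- The subgroup is taken to be the kernel of `χ`, and `hχ` identifies its elements with the
  -- classes satisfying `IsInPicZero`.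
  refine ⟨_, hG, χ.ker, hχ, χ, hf, rfl, fun a => ?_, fun P Q => ?_⟩
  · obtain ⟨c, hc⟩ := QuotientAddGroup.mk_surjective (Multiplicative.toAdd a)
    obtain ⟨l, m, hl⟩ := IsPotential.exists_of_cocycle hU hV c
    obtain ⟨P, hP⟩ := hl.exists_isChernCocycle hU hV
    exact ⟨⟦P⟧, ((hf P c).2 hP).trans (congrArg Multiplicative.ofAdd hc)⟩
  · rw [← div_eq_one, ← map_div, ← MonoidHom.mem_ker]
    constructor
    · intro h
      obtain ⟨K, hK⟩ := Quotient.exists_rep ((⟦P⟧ : RelPic Φ) / (⟦Q⟧ : RelPic Φ))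
      exact ⟨K, (hG K Q P).1 (by rw [hK, div_mul_cancel]), (hχ K).1 (hK ▸ h)⟩
    · rintro ⟨K, hK, hK0⟩
      rw [← (hG K Q P).2 hK, mul_div_cancel_right]
      exact (hχ K).2 hK0
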